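/- **MOY graphs.** A *MOY graph* $\Gamma$ is an oriented trivalent graph embedded in the plane (closed edges without vertices are allowed) with a coloring $\mathsf c$ of its edges by non-negative integers, such that at each vertex either one edge $e$ comes in and two edges $e_1,e_2$ go out, or $e_1,e_2$ come in and $e$ goes out, and $\mathsf c(e)=\mathsf c(e_1)+\mathsf c(e_2)$; here $e_1$ is to the left of $e_2$ when one looks in the direction of $e$. For $N\ge 1$ let $\mathcal N=\{2k-N+1 : k=0,\dots,N-1\}$. A *state* $\varphi$ of $\Gamma$ assigns to each edge $e$ a set $\varphi(e)\subseteq\mathcal N$ with $\#\varphi(e)=\mathsf c(e)$, such that $\varphi(e)=\varphi(e_1)\cup\varphi(e_2)$ at each vertex. Put $$\mathrm{wt}(v;\varphi)=\tfrac12\mathsf c(e_1)\mathsf c(e_2)-\#\{(a_1,a_2)\in\varphi(e_1)\times\varphi(e_2) : a_1>a_2\},\qquad \mathrm{rot}(\varphi)=\sum_{C}\varphi(C)\,\mathrm{rot}(C),$$ where $C$ runs over the oriented circles formed, for each $i\in\mathcal N$, by the edges $e$ with $i\in\varphi(e)$, $\varphi(C)=i$ for such a circle, and $\mathrm{rot}(C)$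 is its rotation number ($+1$ for counterclockwise). The $\mathfrak{sl}(N)$ MOY polynomial is $\langle\Gamma\rangle_N=\sum_\varphi\big(\prod_v q^{\mathrm{wt}(v;\varphi)}\big)q^{\mathrm{rot}(\varphi)}$; it is $0$ if some color exceeds $N$. **Kauffman–Vogel polynomial.** The Kauffman–Vogel polynomial $P(D)(q,a)$ is the invariant of unoriented knotted $4$-valent graph diagrams $D$ under regular rigid vertex isotopy that is determined by $P(\emptyset)=1$ and the following local relations: 1. deleting a circle that bounds an empty disc gives the factor $\frac{a-a^{-1}}{q-q^{-1}}+1$; 2. $P(X_+)-P(X_-)=(q-q^{-1})\big(P(V)-P(H)\big)$; 3. removing a kink whose loop lies to the right of a vertical strand and whose crossing is $X_+$ gives the factor $a$; 4. $P(\times)=-P(X_+)+q\,P(V)+q^{-1}P(H)=-P(X_-)+q^{-1}P(V)+q\,P(H)$. Here $X_+$ (resp. $X_-$) is the crossing whose upper branch runs from lower left to upper right (resp. from lower right to upper left), $V$ consists of two vertical arcs (left and right), $H$ consists of two horizontal arcs (one joining the lower end points, one joining the upper ones), and $\times$ is a $4$-valent vertex. That is, these relations reduce $D$ to $P(D)$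 times the empty diagram. Put $P_N(D)(q)=P(D)(q,q^{N-1})$. **Mostly $2$-colored graphs.** A MOY graph is *mostly $2$-colored* if all of its edges are colored by $2$ except in local configurations of the following two types (up to planar isotopy), which contain all its vertices; all four outer edges are colored by $2$ and point upward, two coming in from below and two going out above. *Type one*: the two incoming edges merge into an upward edge colored by $4$, which splits into the two outgoing edges. *Type two*: a square whose left and right sides point upward with colors $3$ and $1$, whose lower side points left with color $1$ and whose upper side points right with color $1$; the incoming edges end at its lower corners and the outgoing edges start at its upper corners. **Theorem.** Let $\Gamma$ be a mostly $2$-colored MOY graph. Remove the $4$-colored edge in every type one configuration (which leaves one arc joining the two lower legs and one joining the two upper legs), shrink the square in every type two configuration to a vertex, forget colors and orientations, and smooth out all vertices of valence $2$. This gives an unoriented $4$-valent graph $G(\Gamma)$ embedded in the plane. Then $$\langle\Gamma\rangle_4=P_6(G(\Gamma)).$$ -/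

import Mathlib

/-!
# Plane graphs, the `sl(N)` MOY polynomial and the Kauffman-Vogel polynomial

Plane graphs and diagrams are presented in Morse position: a closed diagram is cut by horizontal
lines into finitely many slices, listed from bottom to top.  Each slice contains exactly one
elementary piece (a minimum, a maximum, a vertex or a crossing, with its legs pointing up and down
as in the pictures below) and vertical strands to the left and to the right of it.  Every closed
plane diagram has such a presentation after a planar isotopy, which also turns a small disc around
each vertex or local configuration into upright position.
-/

/-- One horizontal slice: what stands to the left of the elementary piece, the piece, and what
stands to the right of it. -/
structure Slice (β π : Type) where
  left : β
  piece : π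
  right : β

/-- `Composes src tgt b w b'`: the slices of `w`, stacked from bottom to top, fit together, start at
the row of end points `b` and finish at the row of end points `b'`. -/
def Composes {σ β : Type} (src tgt : σ → β) : β → List σ → β → Prop
  | b, [], b' => b = b'
  | b, s :: w, b' => src s = b ∧ Composes src tgt (tgt s) w b'

theorem Composes.append {σ β : Type} {src tgt : σ → β} {b b' b'' : β} {w w' : List σ}
    (h : Composes src tgt b w b') (h' : Composes src tgt b' w' b'') :
    Composes src tgt b (w ++ w') b'' := by
  induction w generalizing b with
  | nil => cases h; exact h'
  | cons s w ih => exact ⟨h.1, ih h.2⟩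

/-- If each slice of a closed diagram is replaced by a stack of slices with the corresponding end
points, then the result is again a diagram. -/
theorem Composes.flatMap {σ β τ γ : Type} {src tgt : σ → β} {src' tgt' : τ → γ}
    (f : σ → List τ) (g : β → γ) (hf : ∀ s, Composes src' tgt' (g (src s)) (f s) (g (tgt s)))
    {b b' : β} {w : List σ} (h : Composes src tgt b w b') :
    Composes src' tgt' (g b) (w.flatMap f) (g b') := by
  induction w generalizing b with
  | nil => cases h; rfl
  | cons s w ih =>
    obtain ⟨h₁, h₂⟩ := h
    subst h₁
    rw [List.flatMap_cons]
    exact (hf s).append (ih h₂)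

/-! ## The coefficients -/

/-- The field `ℚ(q^{1/2})` of rational functions in an indeterminate `q^{1/2}`. -/
abbrev QField : Type := RatFunc ℚ

/-- The indeterminate `q^{1/2}`. -/
noncomputable def qHalf : QField := RatFunc.X

/-- `q = (q^{1/2})²`. -/
noncomputable def qVar : QField := qHalf ^ 2

theorem qVar_ne_zero : qVar ≠ 0 := pow_ne_zero 2 RatFunc.X_ne_zero

/-- The ring `ℚ(q^{1/2})[a, a⁻¹]` in which the two-variable polynomial takes its values; the
variable `a` is `LaurentPolynomial.T 1`. -/
abbrev QARing : Type := LaurentPolynomial QField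

/-! ## MOY graphs -/

/-- The direction of an oriented strand, relative to the upward vertical. -/
inductive Dir
  | up
  | down

def Dir.flip : Dir → Dir
  | up => down
  | down => up

/-- The signed half turn of a minimum or maximum whose left leg has the given direction, in units
of `1/2`: it is traversed clockwise (`-1`) if the left leg points up, and counterclockwise (`+1`)
if the left leg points down. -/
def Dir.turn : Dir → ℤ
  | up => -1
  | down => 1

/-- The elementary pieces of an oriented trivalent plane graph whose edges carry labels in `α`:
* `cup d x`: a minimum on an edge labelled `x`, whose left leg has direction `d`;
* `cap d x`: a maximum on an edge labelled `x`, whose left leg has direction `d`;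
* `merge x y`: a vertex at which edges `e₁` (left, labelled `x`) and `e₂` (right, labelled `y`)
  come in from below and one edge `e` goes out upwards;
* `split x y`: a vertex at which one edge `e` comes in from below and edges `e₁` (left, labelled
  `x`) and `e₂` (right, labelled `y`) go out upwards. -/
inductive MOYPiece (α : Type)
  | cup (d : Dir) (x : α)
  | cap (d : Dir) (x : α)
  | merge (x y : α)
  | split (x y : α)

namespace MOYPiece

/-- The row of strands below a piece; `op` gives the label of the edge `e` at a vertex from those
of `e₁` and `e₂`. -/
def bot {α : Type} (op : α → α → α) : MOYPiece α → List (Dir × α)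
  | cup _ _ => []
  | cap d x => [(d, x), (d.flip, x)]
  | merge x y => [(Dir.up, x), (Dir.up, y)]
  | split x y => [(Dir.up, op x y)]

/-- The row of strands above a piece. -/
def top {α : Type} (op : α → α → α) : MOYPiece α → List (Dir × α)
  | cup d x => [(d, x), (d.flip, x)]
  | cap _ _ => []
  | merge x y => [(Dir.up, op x y)]
  | split x y => [(Dir.up, x), (Dir.up, y)]

def map {α β : Type} (f : α → β) : MOYPiece α → MOYPiece β
  | cup d x => cup d (f x)
  | cap d x => cap d (f x)
  | merge x y => merge (f x) (f y)
  | split x y => split (f x) (f y)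

def labels {α : Type} : MOYPiece α → List α
  | cup _ x => [x]
  | cap _ x => [x]
  | merge x y => [x, y]
  | split x y => [x, y]

end MOYPiece

abbrev MOYSlice (α : Type) : Type := Slice (List (Dir × α)) (MOYPiece α)

namespace MOYSlice

def src {α : Type} (op : α → α → α) (s : MOYSlice α) : List (Dir × α) :=
  s.left ++ s.piece.bot op ++ s.right

def tgt {α : Type} (op : α → α → α) (s : MOYSlice α) : List (Dir × α) :=
  s.left ++ s.piece.top op ++ s.right

def map {α β : Type} (f : α → β) (s : MOYSlice α) : MOYSlice β :=
  ⟨s.left.map (Prod.map id f), s.piece.map f, s.right.map (Prod.map id f)⟩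

def labels {α : Type} (s : MOYSlice α) : List α :=
  s.left.map Prod.snd ++ s.piece.labels ++ s.right.map Prod.snd

end MOYSlice

/-- A MOY graph: a closed oriented trivalent plane graph, possibly with closed edges without
vertices, whose edges carry colors in `ℕ` such that the color of `e` is the sum of the colors of
`e₁` and `e₂` at each vertex. -/
structure MOYGraph where
  word : List (MOYSlice ℕ)
  closed : Composes (MOYSlice.src (· + ·)) (MOYSlice.tgt (· + ·)) [] word []

/-! ## The MOY state sum -/

/-- The set `{2k - N + 1 | k = 0, …, N - 1}`. -/
def moyIndex (N : ℕ) : Finset ℤ :=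
  (Finset.range N).image fun k : ℕ => 2 * (k : ℤ) - N + 1

/-- `π(A, B)`, the number of pairs `(a, b)` in `A × B` with `a > b`. -/
def moyPi (A B : Finset ℤ) : ℕ :=
  ((A ×ˢ B).filter fun p => p.1 > p.2).card

/-- The condition `#φ(e) = c(e)` for the edge `e` at a vertex, where `φ(e) = φ(e₁) ∪ φ(e₂)` and
`c(e) = c(e₁) + c(e₂)`: the sets at `e₁` and `e₂` are disjoint. -/
def MOYPiece.SumDisjoint : MOYPiece (Finset ℤ) → Prop
  | cup _ _ => True
  | cap _ _ => True
  | merge A B => Disjoint A B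
  | split A B => Disjoint A B

/-- A state of `Γ` assigns to each edge `e` a subset `φ(e)` of `{2k - N + 1}` of size `c(e)`, such
that `φ(e) = φ(e₁) ∪ φ(e₂)` at each vertex.  It is recorded as the same plane graph with the sets
`φ(e)` as labels: replacing each set by its size gives back `Γ`. -/
structure IsMOYState (N : ℕ) (Γ : MOYGraph) (φ : List (MOYSlice (Finset ℤ))) : Prop where
  color : φ.map (MOYSlice.map Finset.card) = Γ.word
  fits : Composes (MOYSlice.src (· ∪ ·)) (MOYSlice.tgt (· ∪ ·)) [] φ []
  subset : ∀ s ∈ φ, ∀ A ∈ s.labels, A ⊆ moyIndex N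
  disjoint : ∀ s ∈ φ, s.piece.SumDisjoint

theorem finite_lists_of_map {α β : Type} (f : α → β) (P : α → Prop)
    (h : ∀ b, {a | f a = b ∧ P a}.Finite) (m : List β) :
    {l : List α | l.map f = m ∧ ∀ a ∈ l, P a}.Finite := by
  induction m with
  | nil =>
    refine (Set.finite_singleton []).subset ?_
    rintro l ⟨hl, -⟩
    simpa using hl
  | cons b m ih =>
    refine (Set.Finite.image2 List.cons (h b) ih).subset ?_
    rintro l ⟨hl, hP⟩
    obtain ⟨a, l', rfl, ha, hl'⟩ := List.map_eq_cons_iff.1 hl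
    exact ⟨a, ⟨ha, hP a (by simp)⟩, l', ⟨hl', fun x hx => hP x (by simp [hx])⟩, rfl⟩

theorem finite_moySlices (S : Finset ℤ) (t : MOYSlice ℕ) :
    {s : MOYSlice (Finset ℤ) | MOYSlice.map Finset.card s = t ∧ ∀ A ∈ s.labels, A ⊆ S}.Finite := by
  have hS : {A : Finset ℤ | A ⊆ S}.Finite :=
    S.powerset.finite_toSet.subset fun A hA => by simpa using hA
  have hrow : ∀ m : List (Dir × ℕ), {l : List (Dir × Finset ℤ) |
      l.map (Prod.map id Finset.card) = m ∧ ∀ a ∈ l, a.2 ⊆ S}.Finite := by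
    refine finite_lists_of_map _ _ fun b => ?_
    refine (hS.image (Prod.mk b.1)).subset ?_
    rintro ⟨d, A⟩ ⟨rfl, hA⟩
    exact ⟨A, hA, rfl⟩
  have hpiece : {p : MOYPiece (Finset ℤ) |
      p.map Finset.card = t.piece ∧ ∀ A ∈ p.labels, A ⊆ S}.Finite := by
    rcases ht : t.piece with ⟨d, n⟩ | ⟨d, n⟩ | ⟨m, n⟩ | ⟨m, n⟩
    · refine (hS.image (MOYPiece.cup d)).subset ?_
      rintro (⟨d', A⟩ | ⟨d', A⟩ | ⟨A, B⟩ | ⟨A, B⟩) ⟨h, hA⟩ <;> simp [MOYPiece.map] at h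
      exact ⟨A, hA A (by simp [MOYPiece.labels]), by rw [h.1]⟩
    · refine (hS.image (MOYPiece.cap d)).subset ?_
      rintro (⟨d', A⟩ | ⟨d', A⟩ | ⟨A, B⟩ | ⟨A, B⟩) ⟨h, hA⟩ <;> simp [MOYPiece.map] at h
      exact ⟨A, hA A (by simp [MOYPiece.labels]), by rw [h.1]⟩
    · refine (Set.Finite.image2 MOYPiece.merge hS hS).subset ?_
      rintro (⟨d', A⟩ | ⟨d', A⟩ | ⟨A, B⟩ | ⟨A, B⟩) ⟨h, hA⟩ <;> simp [MOYPiece.map] at h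
      exact ⟨A, hA A (by simp [MOYPiece.labels]), B, hA B (by simp [MOYPiece.labels]), rfl⟩
    · refine (Set.Finite.image2 MOYPiece.split hS hS).subset ?_
      rintro (⟨d', A⟩ | ⟨d', A⟩ | ⟨A, B⟩ | ⟨A, B⟩) ⟨h, hA⟩ <;> simp [MOYPiece.map] at h
      exact ⟨A, hA A (by simp [MOYPiece.labels]), B, hA B (by simp [MOYPiece.labels]), rfl⟩
  refine (((hrow t.left).prod (hpiece.prod (hrow t.right))).image
    fun x => (⟨x.1, x.2.1, x.2.2⟩ : MOYSlice (Finset ℤ))).subset ?_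
  rintro ⟨l, p, r⟩ ⟨rfl, h⟩
  simp only [MOYSlice.labels, List.mem_append, List.mem_map] at h
  exact ⟨(l, p, r), ⟨⟨rfl, fun a ha => h a.2 (Or.inl (Or.inl ⟨a, ha, rfl⟩))⟩,
    ⟨rfl, fun A hA => h A (Or.inl (Or.inr hA))⟩,
    ⟨rfl, fun a ha => h a.2 (Or.inr ⟨a, ha, rfl⟩)⟩⟩, rfl⟩

theorem finite_moyStates (N : ℕ) (Γ : MOYGraph) : {φ | IsMOYState N Γ φ}.Finite :=
  (finite_lists_of_map _ _ (finite_moySlices (moyIndex N)) Γ.word).subset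
    fun _ h => ⟨h.color, h.subset⟩

/-- Twice the weight of a vertex, `wt(v; φ) = c(e₁) c(e₂) / 2 - π(φ(e₁), φ(e₂))`. -/
def MOYPiece.twiceWeight : MOYPiece (Finset ℤ) → ℤ
  | cup _ _ => 0
  | cap _ _ => 0
  | merge A B => A.card * B.card - 2 * moyPi A B
  | split A B => A.card * B.card - 2 * moyPi A B

/-- The contribution of a piece to twice the rotation number of the circles that a state assigns
to the index `i`.  These circles run along the edges whose set contains `i`, and the rotation number
of a circle in Morse position is half the signed number of its minima and maxima. -/
def MOYPiece.turn (i : ℤ) : MOYPiece (Finset ℤ) → ℤ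
  | cup d A => if i ∈ A then d.turn else 0
  | cap d A => if i ∈ A then d.turn else 0
  | merge _ _ => 0
  | split _ _ => 0

/-- Twice `rot(φ) = ∑ φ(C) rot(C)`, the sum over the circles `C` of the state `φ`, here grouped by
their index `i = φ(C)`. -/
def twiceRot (N : ℕ) (φ : List (MOYSlice (Finset ℤ))) : ℤ :=
  ∑ i ∈ moyIndex N, i * (φ.map fun s => s.piece.turn i).sum

/-- The `sl(N)` MOY polynomial `⟨Γ⟩_N = ∑_φ (∏_v q^{wt(v; φ)}) q^{rot(φ)}`.  If some color exceeds
`N`, there are no states and the sum is `0`. -/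
noncomputable def MOYGraph.bracket (N : ℕ) (Γ : MOYGraph) : QField :=
  ∑ φ ∈ (finite_moyStates N Γ).toFinset,
    (φ.map fun s => qHalf ^ s.piece.twiceWeight).prod * qHalf ^ twiceRot N φ

/-! ## Knotted 4-valent graphs and the Kauffman-Vogel polynomial -/

/-- The elementary pieces of a diagram of an unoriented knotted 4-valent graph: minimum, maximum,
the crossing whose upper branch runs from lower left to upper right (`slash`), the crossing whose
upper branch runs from lower right to upper left (`backslash`), and the 4-valent vertex with two
legs pointing down and two pointing up. -/
inductive KVPiece
  | cup
  | cap
  | slash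
  | backslash
  | vertex

def KVPiece.bot : KVPiece → ℕ
  | cup => 0
  | _ => 2

def KVPiece.top : KVPiece → ℕ
  | cap => 0
  | _ => 2

/-- A slice of an unoriented diagram; `left` and `right` are numbers of vertical strands. -/
abbrev KVSlice : Type := Slice ℕ KVPiece

def KVSlice.src (s : KVSlice) : ℕ := s.left + s.piece.bot + s.right

def KVSlice.tgt (s : KVSlice) : ℕ := s.left + s.piece.top + s.right

/-- A closed diagram of an unoriented knotted 4-valent graph.  Those without `slash` and
`backslash` are the 4-valent graphs embedded in the plane. -/
structure KnottedGraph where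
  word : List KVSlice
  closed : Composes KVSlice.src KVSlice.tgt 0 word 0

namespace KnottedGraph

open KVPiece

def empty : KnottedGraph := ⟨[], rfl⟩

/-- The generating moves of regular rigid vertex isotopy of diagrams in Morse position. -/
inductive LocalMove : List KVSlice → List KVSlice → Prop
  /-- Planar isotopy: the heights of two pieces side by side can be exchanged. -/
  | exchange (l m r : ℕ) (x y : KVPiece) : LocalMove
      [⟨l, x, m + y.bot + r⟩, ⟨l + x.top + m, y, r⟩]
      [⟨l + x.bot + m, y, r⟩, ⟨l, x, m + y.top + r⟩]
  /-- Planar isotopy: a maximum next to a minimum on a strand can be straightened. -/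
  | zigzag_left (l r : ℕ) : LocalMove [⟨l, cup, r + 1⟩, ⟨l + 1, cap, r⟩] []
  | zigzag_right (l r : ℕ) : LocalMove [⟨l + 1, cup, r⟩, ⟨l, cap, r + 1⟩] []
  /-- Planar isotopy: a crossing or a vertex can be turned through a minimum or a maximum. -/
  | cup_slash (l r : ℕ) : LocalMove
      [⟨l, cup, r + 1⟩, ⟨l + 1, slash, r⟩] [⟨l + 1, cup, r⟩, ⟨l, backslash, r + 1⟩]
  | cup_backslash (l r : ℕ) : LocalMove
      [⟨l, cup, r + 1⟩, ⟨l + 1, backslash, r⟩] [⟨l + 1, cup, r⟩, ⟨l, slash, r + 1⟩]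
  | cup_vertex (l r : ℕ) : LocalMove
      [⟨l, cup, r + 1⟩, ⟨l + 1, vertex, r⟩] [⟨l + 1, cup, r⟩, ⟨l, vertex, r + 1⟩]
  | slash_cap (l r : ℕ) : LocalMove
      [⟨l + 1, slash, r⟩, ⟨l, cap, r + 1⟩] [⟨l, backslash, r + 1⟩, ⟨l + 1, cap, r⟩]
  | backslash_cap (l r : ℕ) : LocalMove
      [⟨l + 1, backslash, r⟩, ⟨l, cap, r + 1⟩] [⟨l, slash, r + 1⟩, ⟨l + 1, cap, r⟩]
  | vertex_cap (l r : ℕ) : LocalMove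
      [⟨l + 1, vertex, r⟩, ⟨l, cap, r + 1⟩] [⟨l, vertex, r + 1⟩, ⟨l + 1, cap, r⟩]
  /-- Reidemeister move II. -/
  | reidemeister_two (l r : ℕ) : LocalMove [⟨l, slash, r⟩, ⟨l, backslash, r⟩] []
  | reidemeister_two' (l r : ℕ) : LocalMove [⟨l, backslash, r⟩, ⟨l, slash, r⟩] []
  /-- Reidemeister move III; its other forms follow from this one and move II. -/
  | reidemeister_three (l r : ℕ) : LocalMove
      [⟨l, slash, r + 1⟩, ⟨l + 1, slash, r⟩, ⟨l, slash, r + 1⟩]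
      [⟨l + 1, slash, r⟩, ⟨l, slash, r + 1⟩, ⟨l + 1, slash, r⟩]
  /-- A strand passes over a vertex. -/
  | pass_over (l r : ℕ) : LocalMove
      [⟨l, slash, r + 1⟩, ⟨l + 1, slash, r⟩, ⟨l, vertex, r + 1⟩]
      [⟨l + 1, vertex, r⟩, ⟨l, slash, r + 1⟩, ⟨l + 1, slash, r⟩]
  /-- A strand passes under a vertex. -/
  | pass_under (l r : ℕ) : LocalMove
      [⟨l, backslash, r + 1⟩, ⟨l + 1, backslash, r⟩, ⟨l, vertex, r + 1⟩]
      [⟨l + 1, vertex, r⟩, ⟨l, backslash, r + 1⟩, ⟨l + 1, backslash, r⟩]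
  /-- A rigid vertex is flipped over by a half turn. -/
  | flip_vertex (l r : ℕ) : LocalMove [⟨l, vertex, r⟩, ⟨l, slash, r⟩] [⟨l, slash, r⟩, ⟨l, vertex, r⟩]

/-- `D` consists of the slices `w`, with the slices `below` under them and `above` over them. -/
def IsStack (D : KnottedGraph) (below w above : List KVSlice) : Prop :=
  D.word = below ++ w ++ above

/-- The constant `q` and the variable `a` in `ℚ(q^{1/2})[a, a⁻¹]`. -/
noncomputable def q : QARing := LaurentPolynomial.C qVar

noncomputable def qInv : QARing := LaurentPolynomial.C qVar⁻¹

noncomputable def a : QARing := LaurentPolynomial.T 1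

noncomputable def aInv : QARing := LaurentPolynomial.T (-1)

/-- `(a - a⁻¹) / (q - q⁻¹) + 1`. -/
noncomputable def loopValue : QARing :=
  (a - aInv) * LaurentPolynomial.C (qVar - qVar⁻¹)⁻¹ + 1

open Finsupp in
/-- The relations between diagrams by which the Kauffman-Vogel polynomial is defined.  In each of
them the diagrams agree outside the part that is displayed. -/
inductive SkeinRelation : (KnottedGraph →₀ QARing) → Prop
  /-- Invariance under regular rigid vertex isotopy. -/
  | isotopy (below above w w' : List KVSlice) (D D' : KnottedGraph) (h : LocalMove w w')
      (hD : D.IsStack below w above) (hD' : D'.IsStack below w' above) :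
      SkeinRelation (single D 1 - single D' 1)
  /-- `P(circle) = (a - a⁻¹) / (q - q⁻¹) + 1`, for a circle that bounds an empty disc. -/
  | circle (below above : List KVSlice) (l r : ℕ) (D D' : KnottedGraph)
      (hD : D.IsStack below [⟨l, cup, r⟩, ⟨l, cap, r⟩] above) (hD' : D'.IsStack below [] above) :
      SkeinRelation (single D 1 - loopValue • single D' 1)
  /-- `P(slash) - P(backslash) = (q - q⁻¹) (P( )( ) - P(≍))`. -/
  | crossing (below above : List KVSlice) (l r : ℕ) (D₁ D₂ D₃ D₄ : KnottedGraph)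
      (h₁ : D₁.IsStack below [⟨l, slash, r⟩] above)
      (h₂ : D₂.IsStack below [⟨l, backslash, r⟩] above)
      (h₃ : D₃.IsStack below [] above)
      (h₄ : D₄.IsStack below [⟨l, cap, r⟩, ⟨l, cup, r⟩] above) :
      SkeinRelation
        (single D₁ 1 - single D₂ 1 - (q - qInv) • (single D₃ 1 - single D₄ 1))
  /-- Removing a kink on the right of a strand, with the `slash` crossing, gives the factor `a`. -/
  | kink (below above : List KVSlice) (l r : ℕ) (D D' : KnottedGraph)
      (hD : D.IsStack below [⟨l + 1, cup, r⟩, ⟨l, slash, r + 1⟩, ⟨l + 1, cap, r⟩] above)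
      (hD' : D'.IsStack below [] above) :
      SkeinRelation (single D 1 - a • single D' 1)
  /-- `P(vertex) = - P(slash) + q P( )( ) + q⁻¹ P(≍)`. -/
  | vertex_slash (below above : List KVSlice) (l r : ℕ) (D D₁ D₃ D₄ : KnottedGraph)
      (h : D.IsStack below [⟨l, vertex, r⟩] above)
      (h₁ : D₁.IsStack below [⟨l, slash, r⟩] above)
      (h₃ : D₃.IsStack below [] above)
      (h₄ : D₄.IsStack below [⟨l, cap, r⟩, ⟨l, cup, r⟩] above) :
      SkeinRelation (single D 1 - (-single D₁ 1 + q • single D₃ 1 + qInv • single D₄ 1))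
  /-- `P(vertex) = - P(backslash) + q⁻¹ P( )( ) + q P(≍)`. -/
  | vertex_backslash (below above : List KVSlice) (l r : ℕ) (D D₂ D₃ D₄ : KnottedGraph)
      (h : D.IsStack below [⟨l, vertex, r⟩] above)
      (h₂ : D₂.IsStack below [⟨l, backslash, r⟩] above)
      (h₃ : D₃.IsStack below [] above)
      (h₄ : D₄.IsStack below [⟨l, cap, r⟩, ⟨l, cup, r⟩] above) :
      SkeinRelation (single D 1 - (-single D₂ 1 + qInv • single D₃ 1 + q • single D₄ 1))

/-- `p` is the value of the Kauffman-Vogel polynomial at `D`: the defining relations reduce `D` to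
`p` times the empty diagram. -/
def IsKauffmanVogel (D : KnottedGraph) (p : QARing) : Prop :=
  Finsupp.single D 1 - p • Finsupp.single empty 1 ∈
    Submodule.span QARing {x : KnottedGraph →₀ QARing | SkeinRelation x}

open Classical in
/-- The Kauffman-Vogel polynomial `P(D)(q, a)`. -/
noncomputable def kauffmanVogel (D : KnottedGraph) : QARing :=
  if h : ∃ p, D.IsKauffmanVogel p then h.choose else 0

/-- The `so(N)` Kauffman-Vogel polynomial `P_N(D)(q) = P(D)(q, q^{N-1})`. -/
noncomputable def kauffmanVogelSO (N : ℕ) (D : KnottedGraph) : QField :=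
  LaurentPolynomial.eval₂ (RingHom.id QField) (Units.mk0 qVar qVar_ne_zero ^ ((N : ℤ) - 1))
    D.kauffmanVogel

end KnottedGraph

/-! ## Mostly 2-colored MOY graphs -/

/-- The elementary pieces of a mostly 2-colored MOY graph: minima and maxima of 2-colored edges, and
the local configurations of type one and type two, drawn with all outer edges pointing up. -/
inductive TwoPiece
  | cup (d : Dir)
  | cap (d : Dir)
  | typeOne
  | typeTwo

namespace TwoPiece

def bot : TwoPiece → List Dir
  | cup _ => []
  | cap d => [d, d.flip]
  | typeOne => [Dir.up, Dir.up]
  | typeTwo => [Dir.up, Dir.up]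

def top : TwoPiece → List Dir
  | cup d => [d, d.flip]
  | cap _ => []
  | typeOne => [Dir.up, Dir.up]
  | typeTwo => [Dir.up, Dir.up]

end TwoPiece

abbrev TwoSlice : Type := Slice (List Dir) TwoPiece

/-- The directed strand `d` as a strand colored by `2`. -/
def colorTwo (d : Dir) : Dir × ℕ := (d, 2)

namespace TwoSlice

def src (s : TwoSlice) : List Dir := s.left ++ s.piece.bot ++ s.right

def tgt (s : TwoSlice) : List Dir := s.left ++ s.piece.top ++ s.right

/-- The part of the MOY graph in a slice.

Type one: two 2-colored edges merge into a 4-colored edge, which splits into two 2-colored edges.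

Type two is a square.  From bottom to top: the right 2-colored edge splits into the lower horizontal
edge, going left with color `1`, and the right side, of color `1`; the lower horizontal edge joins
the left 2-colored edge to form the left side, of color `3`; the left side splits into an outgoing
2-colored edge and the upper horizontal edge, going right with color `1`; this joins the right side
to form the other outgoing 2-colored edge. -/
def toMOY (s : TwoSlice) : List (MOYSlice ℕ) :=
  let l := s.left.map colorTwo
  let r := s.right.map colorTwo
  match s.piece with
  | .cup d => [⟨l, .cup d 2, r⟩]
  | .cap d => [⟨l, .cap d 2, r⟩]
  | .typeOne => [⟨l, .merge 2 2, r⟩, ⟨l, .split 2 2, r⟩]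
  | .typeTwo =>
    [⟨l ++ [(Dir.up, 2)], .split 1 1, r⟩,
     ⟨l, .merge 2 1, [(Dir.up, 1)] ++ r⟩,
     ⟨l, .split 2 1, [(Dir.up, 1)] ++ r⟩,
     ⟨l ++ [(Dir.up, 2)], .merge 1 1, r⟩]

/-- The part of the 4-valent graph in a slice: in type one the 4-colored edge is removed, which
leaves an arc joining the two lower legs and an arc joining the two upper legs; in type two the
square is shrunk to a vertex. -/
def toGraph (s : TwoSlice) : List KVSlice :=
  let l := s.left.length
  let r := s.right.length
  match s.piece with
  | .cup _ => [⟨l, .cup, r⟩]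
  | .cap _ => [⟨l, .cap, r⟩]
  | .typeOne => [⟨l, .cap, r⟩, ⟨l, .cup, r⟩]
  | .typeTwo => [⟨l, .vertex, r⟩]

theorem toMOY_composes (s : TwoSlice) :
    Composes (MOYSlice.src (· + ·)) (MOYSlice.tgt (· + ·))
      (s.src.map colorTwo) s.toMOY (s.tgt.map colorTwo) := by
  rcases s with ⟨l, p, r⟩
  cases p <;> simp [toMOY, Composes, src, tgt, MOYSlice.src, MOYSlice.tgt, TwoPiece.bot,
    TwoPiece.top, MOYPiece.bot, MOYPiece.top, colorTwo]

theorem toGraph_composes (s : TwoSlice) :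
    Composes KVSlice.src KVSlice.tgt s.src.length s.toGraph s.tgt.length := by
  rcases s with ⟨l, p, r⟩
  cases p <;> simp [toGraph, Composes, src, tgt, KVSlice.src, KVSlice.tgt, TwoPiece.bot,
    TwoPiece.top, KVPiece.bot, KVPiece.top] <;> omega

end TwoSlice

/-- A mostly 2-colored MOY graph: all its edges are colored by `2` except in local configurations of
type one and type two. -/
structure MostlyTwoColored where
  word : List TwoSlice
  closed : Composes TwoSlice.src TwoSlice.tgt [] word []

namespace MostlyTwoColored

/-- The underlying MOY graph. -/
def toMOY (Γ : MostlyTwoColored) : MOYGraph where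
  word := Γ.word.flatMap TwoSlice.toMOY
  closed := Γ.closed.flatMap TwoSlice.toMOY (List.map colorTwo) TwoSlice.toMOY_composes

/-- The unoriented plane 4-valent graph `G(Γ)`. -/
def toGraph (Γ : MostlyTwoColored) : KnottedGraph where
  word := Γ.word.flatMap TwoSlice.toGraph
  closed := Γ.closed.flatMap TwoSlice.toGraph List.length TwoSlice.toGraph_composes

end MostlyTwoColored

/-! Both sides are computed by the same vertex model. A strand coloured by 2 carries a two-element
subset of {-3, -1, 1, 3}; the six subsets index a basis of the exterior square of the vector
representation of sl(4), which is the vector representation of so(6). This accounts for 4 on one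
side and 6 on the other. The complement of a two-element set again has two elements, and the four
numbers add up to 0. Hence reversing a strand and complementing its label preserves the weights of
minima and maxima, and the orientation of 2-coloured strands can be forgotten.

On the MOY side, all weights are local, so the state sum is a product of transfer operators, one for
each slice. In type one, the two incoming sets must be complementary, and the weight of the merge is
then that of a maximum; the configuration acts as a maximum followed by a minimum. Type two gives a
36 by 36 matrix, which is taken as the matrix of the 4-valent vertex (`typeOneTerms_toSet`,
`typeTwoTerms_toSet`, `TwoSlice.transferAll_toMOY`).

On the Kauffman-Vogel side, the vertex relations force the matrices of the two crossings. It remains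
to see that the resulting model satisfies every defining relation at a = q⁵. Each relation involves
at most three strands besides idle ones, so this is a finite computation, except for the exchange of
distant pieces and for Reidemeister move III, which follows from two smaller identities.
Consequently any value p that the relations assign to D specializes to the model at D
(`modelSum_eq_zero`, `IsKauffmanVogel.specialize_eq`).

Finally, such a p must exist for every D (`exists_isKauffmanVogel`). A diagram is built from bottom
to top, and every half diagram is kept in the span of layered matchings: the leftmost end belongs to
a minimum whose right leg passes over all the rest, and the rest is of the same form. This span is
stable under putting any piece on top, and with no free ends it is spanned by the empty diagram. -/

/-! ## Formal sums of rows -/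

/-- The two-element subsets of `{-3, -1, 1, 3}`, where `s₁₂` consists of the smallest and the
second smallest number, and so on. -/
inductive Pair
  | s₁₂
  | s₁₃
  | s₁₄
  | s₂₃
  | s₂₄
  | s₃₄

namespace Pair

/-- The position in the lexicographic order. -/
def code : Pair → ℕ
  | s₁₂ => 0
  | s₁₃ => 1
  | s₁₄ => 2
  | s₂₃ => 3
  | s₂₄ => 4
  | s₃₄ => 5

def compl : Pair → Pair
  | s₁₂ => s₃₄
  | s₁₃ => s₂₄
  | s₁₄ => s₂₃
  | s₂₃ => s₁₄
  | s₂₄ => s₁₃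
  | s₃₄ => s₁₂

def all : List Pair := [s₁₂, s₁₃, s₁₄, s₂₃, s₂₄, s₃₄]

theorem mem_all (x : Pair) : x ∈ all := by cases x <;> simp [all]

def beq (x y : Pair) : Bool := Nat.beq x.code y.code

theorem beq_eq_true {x y : Pair} : x.beq y = true ↔ x = y := by
  cases x <;> cases y <;> simp [beq, code]

theorem compl_compl (x : Pair) : x.compl.compl = x := by cases x <;> rfl

end Pair

/-- A term `c q^{e/2} [row]`, recorded as `((row, e), c)`. -/
abbrev RowTerm : Type := (List Pair × ℤ) × ℤ

/-- Equality of integers, in a form that the kernel evaluates fast. -/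
def Int.fastBeq : ℤ → ℤ → Bool
  | .ofNat m, .ofNat n => Nat.beq m n
  | .negSucc m, .negSucc n => Nat.beq m n
  | _, _ => false

theorem Int.eq_of_fastBeq {m n : ℤ} (h : m.fastBeq n = true) : m = n := by
  cases m <;> cases n <;> simp_all [Int.fastBeq]

def Pair.rowBeq : List Pair → List Pair → Bool
  | [], [] => true
  | x :: l, y :: m => bif x.beq y then rowBeq l m else false
  | _, _ => false

theorem Pair.eq_of_rowBeq {l m : List Pair} (h : rowBeq l m = true) : l = m := by
  induction l generalizing m with
  | nil => cases m <;> simp_all [rowBeq]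
  | cons x l ih =>
    cases m with
    | nil => simp [rowBeq] at h
    | cons y m =>
      cases hxy : x.beq y
      · simp [rowBeq, hxy] at h
      · rw [beq_eq_true.1 hxy, ih (by simpa [rowBeq, hxy] using h)]

namespace RowTerm

def sameMonomial (t u : RowTerm) : Bool :=
  bif t.1.2.fastBeq u.1.2 then Pair.rowBeq t.1.1 u.1.1 else false

theorem eq_of_sameMonomial {t u : RowTerm} (h : sameMonomial t u = true) : t.1 = u.1 := by
  cases h' : t.1.2.fastBeq u.1.2
  · simp [sameMonomial, h'] at h
  · exact Prod.ext (Pair.eq_of_rowBeq (by simpa [sameMonomial, h'] using h)) (Int.eq_of_fastBeq h')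

noncomputable def value (g : List Pair → QField) (t : RowTerm) : QField :=
  t.2 * (qHalf ^ t.1.2 * g t.1.1)

/-- The value of a formal sum of terms at a function of rows. -/
noncomputable def sumValue (g : List Pair → QField) (L : List RowTerm) : QField :=
  (L.map (value g)).sum

def mapRow (f : List Pair → List Pair) (t : RowTerm) : RowTerm := ((f t.1.1, t.1.2), t.2)

/-- Multiplication by the monomial `c q^{e/2}`. -/
def scale (e c : ℤ) (t : RowTerm) : RowTerm := ((t.1.1, e + t.1.2), c * t.2)

/-- Adds a term to a formal sum, collecting equal monomials. -/
def collect (t : RowTerm) : List RowTerm → List RowTerm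
  | [] => [t]
  | u :: L => bif sameMonomial t u then
      (bif (t.2 + u.2).fastBeq 0 then L else (u.1, t.2 + u.2) :: L) else u :: collect t L

def normalize (L : List RowTerm) : List RowTerm := L.foldr collect []

theorem sumValue_nil (g) : sumValue g [] = 0 := rfl

theorem sumValue_cons (g) (t : RowTerm) (L) :
    sumValue g (t :: L) = t.value g + sumValue g L := by simp [sumValue]

theorem sumValue_append (g) (L L' : List RowTerm) :
    sumValue g (L ++ L') = sumValue g L + sumValue g L' := by simp [sumValue]

theorem sumValue_mapRow (g f) (L : List RowTerm) :
    sumValue g (L.map (mapRow f)) = sumValue (fun r => g (f r)) L := by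
  rw [sumValue, sumValue, List.map_map]
  rfl

theorem qHalf_ne_zero : qHalf ≠ 0 := RatFunc.X_ne_zero

theorem sumValue_scale (g) (e c : ℤ) (L : List RowTerm) :
    sumValue g (L.map (scale e c)) = c * (qHalf ^ e * sumValue g L) := by
  induction L with
  | nil => simp [sumValue]
  | cons t L ih =>
    rw [List.map_cons, sumValue_cons, sumValue_cons, ih]
    simp only [value, scale, zpow_add₀ qHalf_ne_zero, Int.cast_mul]
    ring

theorem sumValue_flatMap (g) {α : Type} (f : α → List RowTerm) (L : List α) :
    sumValue g (L.flatMap f) = (L.map fun t => sumValue g (f t)).sum := by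
  induction L with
  | nil => rfl
  | cons t L ih => rw [List.flatMap_cons, sumValue_append, ih, List.map_cons, List.sum_cons]

theorem sumValue_congr {g g' : List Pair → QField} {L : List RowTerm}
    (h : ∀ t ∈ L, g t.1.1 = g' t.1.1) : sumValue g L = sumValue g' L := by
  rw [sumValue, sumValue]
  exact congrArg _ (List.map_congr_left fun t ht => by rw [value, value, h t ht])

theorem sumValue_add (g g' : List Pair → QField) (L : List RowTerm) :
    sumValue (fun r => g r + g' r) L = sumValue g L + sumValue g' L := by
  induction L with
  | nil => simp [sumValue]
  | cons t L ih =>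
    rw [sumValue_cons, sumValue_cons, sumValue_cons, ih]
    simp only [value]
    ring

theorem sumValue_mul (c : QField) (g : List Pair → QField) (L : List RowTerm) :
    sumValue (fun r => c * g r) L = c * sumValue g L := by
  induction L with
  | nil => simp [sumValue]
  | cons t L ih =>
    rw [sumValue_cons, sumValue_cons, ih]
    simp only [value]
    ring

theorem sumValue_comm (g : List Pair → List Pair → QField) (L L' : List RowTerm) :
    sumValue (fun r => sumValue (g r) L') L = sumValue (fun r' => sumValue (fun r => g r r') L) L' := by
  induction L with
  | nil =>
    simp only [sumValue_nil]
    induction L' with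
    | nil => rfl
    | cons t L' ih => rw [sumValue_cons, ← ih]; simp [value]
  | cons t L ih =>
    simp only [sumValue_cons, ih, sumValue_add]
    congr 1
    simp only [value, sumValue_mul]

theorem sumValue_collect (g) (t : RowTerm) (L) :
    sumValue g (collect t L) = t.value g + sumValue g L := by
  induction L with
  | nil => rfl
  | cons u L ih =>
    unfold collect
    cases h : sameMonomial t u
    · simp only [cond_false, sumValue_cons, ih]
      ring
    · have hv : value g (u.1, t.2 + u.2) = t.value g + u.value g := by
        simp only [value, eq_of_sameMonomial h, Int.cast_add]
        ring
      cases h0 : (t.2 + u.2).fastBeq 0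
      · simp only [cond_true, cond_false, sumValue_cons, hv, add_assoc]
      · rw [Int.eq_of_fastBeq h0] at hv
        simp only [cond_true, sumValue_cons, ← add_assoc, ← hv]
        simp [value]

theorem sumValue_normalize (g) (L : List RowTerm) :
    sumValue g (normalize L) = sumValue g L := by
  rw [normalize]
  induction L with
  | nil => rfl
  | cons t L ih => rw [List.foldr_cons, sumValue_collect, ih, sumValue_cons]

/-- A test for equality of formal sums. -/
def sameSum (L L' : List RowTerm) : Bool :=
  (normalize (L ++ L'.map (scale 0 (-1)))).isEmpty

/-- Collecting terms does not change the value, and here the difference of the two sums collects to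
the empty list. Only this direction is needed, so the test need not be shown complete. -/
theorem sumValue_eq_of_sameSum {L L' : List RowTerm} (h : sameSum L L' = true) (g) :
    sumValue g L = sumValue g L' := by
  have h1 := sumValue_normalize g (L ++ L'.map (scale 0 (-1)))
  rw [List.isEmpty_iff.1 h, sumValue_append, sumValue_scale, sumValue_nil] at h1
  simp at h1
  linear_combination -h1

end RowTerm

/-! ## The vertex model of the `so(6)` Kauffman-Vogel polynomial -/

namespace Pair

/-- Twice the exponent of `q` at a minimum or maximum whose left leg carries the given set: minus
the sum of the set. -/
def arc : Pair → ℤ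
  | s₁₂ => 4
  | s₁₃ => 2
  | s₁₄ => 0
  | s₂₃ => 0
  | s₂₄ => -2
  | s₃₄ => -4

/-- The matrix entries of the vertex in the row of a set and its complement. -/
def vertexRow : Pair → List (Pair × ℤ)
  | s₁₂ => [(s₁₂, 2), (s₁₂, 6), (s₁₃, 4), (s₁₄, 2), (s₂₃, 2), (s₂₄, 0)]
  | s₁₃ => [(s₁₂, 4), (s₁₃, 2), (s₁₃, 2), (s₁₄, 0), (s₂₃, 0), (s₃₄, 0)]
  | s₁₄ => [(s₁₂, 2), (s₁₃, 0), (s₁₄, -2), (s₁₄, 2), (s₂₄, 0), (s₃₄, -2)]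
  | s₂₃ => [(s₁₂, 2), (s₁₃, 0), (s₂₃, -2), (s₂₃, 2), (s₂₄, 0), (s₃₄, -2)]
  | s₂₄ => [(s₁₂, 0), (s₁₄, 0), (s₂₃, 0), (s₂₄, -2), (s₂₄, -2), (s₃₄, -4)]
  | s₃₄ => [(s₁₃, 0), (s₁₄, -2), (s₂₃, -2), (s₂₄, -4), (s₃₄, -6), (s₃₄, -2)]

def vertexTerms (x y : Pair) : List RowTerm :=
  bif x.beq y then []
  else bif y.beq x.compl then x.vertexRow.map fun z => (([z.1, z.1.compl], z.2), 1)
  else [(([x, y], bif Nat.blt x.code y.code then 2 else -2), 1), (([y, x], 0), 1)]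

/-- The matrix entries of a minimum over a maximum. -/
def capCupTerms (x y : Pair) : List RowTerm :=
  bif y.beq x.compl then all.map fun z => (([z, z.compl], x.arc + z.arc), 1) else []

/-- The matrix entries of the crossings, with `e = 2` for `slash` and `e = -2` for `backslash`. -/
def crossingTerms (e : ℤ) (x y : Pair) : List RowTerm :=
  RowTerm.normalize ((vertexTerms x y).map (RowTerm.scale 0 (-1)) ++ [(([x, y], e), 1)] ++
    (capCupTerms x y).map (RowTerm.scale (-e) 1))

end Pair

/-- The vertex model: the row of matrix entries of a piece at a row of labels. -/
def KVPiece.terms : KVPiece → List Pair → List RowTerm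
  | cup, [] => Pair.all.map fun z => (([z, z.compl], z.arc), 1)
  | cap, [x, y] => bif y.beq x.compl then [(([], x.arc), 1)] else []
  | vertex, [x, y] => Pair.vertexTerms x y
  | slash, [x, y] => Pair.crossingTerms 2 x y
  | backslash, [x, y] => Pair.crossingTerms (-2) x y
  | _, _ => []

/-! ### The action of stacks of slices on functions of rows -/

namespace KVSlice

open RowTerm

def terms (s : KVSlice) (row : List Pair) : List RowTerm :=
  (s.piece.terms ((row.drop s.left).take s.piece.bot)).map
    (mapRow fun t => row.take s.left ++ t ++ row.drop (s.left + s.piece.bot))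

/-- The action of a stack of slices on functions of rows. -/
noncomputable def act : List KVSlice → (List Pair → QField) → List Pair → QField
  | [], g, row => g row
  | s :: w, g, row => sumValue (act w g) (s.terms row)

/-- The matrix entries of a stack of slices. -/
def stackTerms : List KVSlice → List Pair → List RowTerm
  | [], row => [((row, 0), 1)]
  | s :: w, row => (s.terms row).flatMap fun t => (stackTerms w t.1.1).map (scale t.1.2 t.2)

/-- The recursive action composes well, whereas the explicit list of matrix entries can be
evaluated. This passes from an evaluated list to an identity valid for every function `g` of the
upper row. -/
theorem sumValue_stackTerms (w : List KVSlice) (g) (row : List Pair) :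
    sumValue g (stackTerms w row) = act w g row := by
  induction w generalizing row with
  | nil => simp [stackTerms, sumValue, act, value]
  | cons s w ih =>
    rw [stackTerms, sumValue_flatMap, act, sumValue]
    simp only [sumValue_scale, ih]
    rfl

theorem act_eq_of_sameSum {w w' : List KVSlice} {row : List Pair}
    (h : sameSum (stackTerms w row) (stackTerms w' row) = true) (g) :
    act w g row = act w' g row := by
  rw [← sumValue_stackTerms, ← sumValue_stackTerms, sumValue_eq_of_sameSum h]

theorem act_eq_of_all_one {w w' : List KVSlice}
    (h : (Pair.all.all fun x => sameSum (stackTerms w [x]) (stackTerms w' [x])) = true)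
    (g) (row : List Pair) (hrow : row.length = 1) : act w g row = act w' g row := by
  obtain ⟨x, rfl⟩ := List.length_eq_one_iff.1 hrow
  exact act_eq_of_sameSum (List.all_eq_true.1 h x x.mem_all) g

theorem act_eq_of_all_two {w w' : List KVSlice}
    (h : (Pair.all.all fun x => Pair.all.all fun y =>
      sameSum (stackTerms w [x, y]) (stackTerms w' [x, y])) = true)
    (g) (row : List Pair) (hrow : row.length = 2) : act w g row = act w' g row := by
  obtain ⟨x, y, rfl⟩ := List.length_eq_two.1 hrow
  exact act_eq_of_sameSum (List.all_eq_true.1 (List.all_eq_true.1 h x x.mem_all) y y.mem_all) g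

theorem act_eq_of_all_three {w w' : List KVSlice}
    (h : (Pair.all.all fun x => Pair.all.all fun y => Pair.all.all fun z =>
      sameSum (stackTerms w [x, y, z]) (stackTerms w' [x, y, z])) = true)
    (g) (row : List Pair) (hrow : row.length = 3) : act w g row = act w' g row := by
  obtain ⟨x, y, z, rfl⟩ := List.length_eq_three.1 hrow
  exact act_eq_of_sameSum (List.all_eq_true.1 (List.all_eq_true.1 (List.all_eq_true.1 h x x.mem_all)
    y y.mem_all) z z.mem_all) g

end KVSlice

/-! ### Linearity and locality of the action -/

namespace KVSlice

open KVPiece RowTerm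

theorem act_append (w w' : List KVSlice) (g) : act (w ++ w') g = act w (act w' g) := by
  funext row
  induction w generalizing row with
  | nil => rfl
  | cons s w ih =>
    simp only [List.cons_append, act]
    congr 1
    funext r
    exact ih r

theorem act_add (w : List KVSlice) (g g' : List Pair → QField) (row) :
    act w (fun r => g r + g' r) row = act w g row + act w g' row := by
  induction w generalizing row with
  | nil => rfl
  | cons s w ih =>
    simp only [act, ← sumValue_add]
    congr 1
    funext r
    exact ih r

theorem act_mul (w : List KVSlice) (c : QField) (g : List Pair → QField) (row) :
    act w (fun r => c * g r) row = c * act w g row := by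
  induction w generalizing row with
  | nil => rfl
  | cons s w ih =>
    simp only [act, ← sumValue_mul]
    congr 1
    funext r
    exact ih r

/-- A slice with `l` more strands on the left and `r` more strands on the right. -/
def widen (l r : ℕ) (s : KVSlice) : KVSlice := ⟨l + s.left, s.piece, r + s.right⟩

theorem terms_eq (l r : ℕ) (p : KVPiece) (a b c : List Pair) (ha : a.length = l)
    (hb : b.length = p.bot) :
    terms ⟨l, p, r⟩ (a ++ b ++ c) = (p.terms b).map (mapRow fun t => a ++ t ++ c) := by
  subst ha
  simp only [terms]
  rw [← hb, List.append_assoc, List.drop_left, List.take_left, List.take_left, ← List.append_assoc,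
    List.drop_left' (by simp)]

theorem length_of_mem_pieceTerms {p : KVPiece} {b : List Pair} {t : RowTerm}
    (h : t ∈ p.terms b) (hb : b.length = p.bot) : t.1.1.length = p.top := by
  have key : ∀ p : KVPiece, p.bot = 2 → (Pair.all.all fun x => Pair.all.all fun y =>
      (p.terms [x, y]).all fun t => t.1.1.length == p.top) = true := by
    intro p hp
    cases p
    · simp [bot] at hp
    all_goals decide +kernel
  by_cases hp : p.bot = 2
  · obtain ⟨x, y, rfl⟩ := List.length_eq_two.1 (hb.trans hp)
    simpa using List.all_eq_true.1 (List.all_eq_true.1 (List.all_eq_true.1 (key p hp) x x.mem_all)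
      y y.mem_all) t h
  · cases p <;> simp [bot] at hp hb
    subst hb
    obtain ⟨x, -, rfl⟩ := List.mem_map.1 h
    rfl

theorem exists_split {s : KVSlice} {row : List Pair} (h : row.length = s.src) :
    ∃ a b c : List Pair, row = a ++ b ++ c ∧ a.length = s.left ∧ b.length = s.piece.bot ∧
      c.length = s.right := by
  refine ⟨row.take s.left, (row.drop s.left).take s.piece.bot, row.drop (s.left + s.piece.bot),
    ?_, ?_, ?_, ?_⟩
  · rw [List.append_assoc, ← List.drop_drop, List.take_append_drop, List.take_append_drop]
  all_goals simp [src] at *; omega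

theorem length_of_mem_terms {s : KVSlice} {row : List Pair} (h : row.length = s.src)
    {t : RowTerm} (ht : t ∈ s.terms row) : t.1.1.length = s.tgt := by
  obtain ⟨a, b, c, rfl, ha, hb, hc⟩ := exists_split h
  rw [terms_eq _ s.right _ a b c ha hb] at ht
  obtain ⟨u, hu, rfl⟩ := List.mem_map.1 ht
  simp [mapRow, length_of_mem_pieceTerms hu hb, tgt, ha, hc, add_assoc]

/-- Each slice sends rows of the length of its source to rows of the length of its target, so only
rows of length `m` reach the upper boundary. Identities that hold for rows of the right length can
thus be used above another stack. -/
theorem act_congr {n m : ℕ} {w : List KVSlice} (hw : Composes src tgt n w m)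
    {g g' : List Pair → QField} (h : ∀ row, row.length = m → g row = g' row)
    {row : List Pair} (hrow : row.length = n) : act w g row = act w g' row := by
  induction w generalizing n row with
  | nil => exact h row (hrow.trans hw)
  | cons s w ih =>
    obtain ⟨h1, h2⟩ := hw
    exact sumValue_congr fun t ht => ih h2 (length_of_mem_terms (hrow.trans h1.symm) ht)

/-- Idle strands are carried along unchanged. This reduces every local relation to the strands that
it really involves. -/
theorem act_widen {n m : ℕ} {w : List KVSlice} (hw : Composes src tgt n w m) (l r : ℕ)
    (g : List Pair → QField) {a b : List Pair} (c : List Pair) (ha : a.length = l)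
    (hb : b.length = n) :
    act (w.map (widen l r)) g (a ++ b ++ c) = act w (fun t => g (a ++ t ++ c)) b := by
  induction w generalizing n b with
  | nil => rfl
  | cons s w ih =>
    obtain ⟨h1, h2⟩ := hw
    rw [List.map_cons, act, act]
    have key : terms (widen l r s) (a ++ b ++ c) =
        (s.terms b).map (mapRow fun t => a ++ t ++ c) := by
      obtain ⟨a', b', c', rfl, ha', hb', hc'⟩ := exists_split (hb.trans h1.symm)
      rw [terms_eq _ s.right _ a' b' c' ha' hb',
        show a ++ (a' ++ b' ++ c') ++ c = (a ++ a') ++ b' ++ (c' ++ c) by simp, widen,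
        terms_eq _ _ _ _ _ _ (by simp [ha, ha']) hb', List.map_map]
      refine List.map_congr_left fun t _ => ?_
      simp [mapRow]
    rw [key, sumValue_mapRow]
    exact sumValue_congr fun t ht => ih h2 (length_of_mem_terms (hb.trans h1.symm) ht)

end KVSlice

/-! ### The local relations on at most three strands, by evaluation of matrices -/

namespace KVSlice

open KVPiece RowTerm

theorem act_zigzag_left (g) (row : List Pair) (h : row.length = 1) :
    act [⟨0, cup, 1⟩, ⟨1, cap, 0⟩] g row = act [] g row :=
  act_eq_of_all_one (by decide +kernel) g row h

theorem act_zigzag_right (g) (row : List Pair) (h : row.length = 1) :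
    act [⟨1, cup, 0⟩, ⟨0, cap, 1⟩] g row = act [] g row :=
  act_eq_of_all_one (by decide +kernel) g row h

theorem act_cup_slash (g) (row : List Pair) (h : row.length = 1) :
    act [⟨0, cup, 1⟩, ⟨1, slash, 0⟩] g row = act [⟨1, cup, 0⟩, ⟨0, backslash, 1⟩] g row :=
  act_eq_of_all_one (by decide +kernel) g row h

theorem act_cup_backslash (g) (row : List Pair) (h : row.length = 1) :
    act [⟨0, cup, 1⟩, ⟨1, backslash, 0⟩] g row = act [⟨1, cup, 0⟩, ⟨0, slash, 1⟩] g row :=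
  act_eq_of_all_one (by decide +kernel) g row h

theorem act_cup_vertex (g) (row : List Pair) (h : row.length = 1) :
    act [⟨0, cup, 1⟩, ⟨1, vertex, 0⟩] g row = act [⟨1, cup, 0⟩, ⟨0, vertex, 1⟩] g row :=
  act_eq_of_all_one (by decide +kernel) g row h

theorem act_slash_cap (g) (row : List Pair) (h : row.length = 3) :
    act [⟨1, slash, 0⟩, ⟨0, cap, 1⟩] g row = act [⟨0, backslash, 1⟩, ⟨1, cap, 0⟩] g row :=
  act_eq_of_all_three (by decide +kernel) g row h

theorem act_backslash_cap (g) (row : List Pair) (h : row.length = 3) :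
    act [⟨1, backslash, 0⟩, ⟨0, cap, 1⟩] g row = act [⟨0, slash, 1⟩, ⟨1, cap, 0⟩] g row :=
  act_eq_of_all_three (by decide +kernel) g row h

theorem act_vertex_cap (g) (row : List Pair) (h : row.length = 3) :
    act [⟨1, vertex, 0⟩, ⟨0, cap, 1⟩] g row = act [⟨0, vertex, 1⟩, ⟨1, cap, 0⟩] g row :=
  act_eq_of_all_three (by decide +kernel) g row h

theorem act_reidemeister_two (g) (row : List Pair) (h : row.length = 2) :
    act [⟨0, slash, 0⟩, ⟨0, backslash, 0⟩] g row = act [] g row :=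
  act_eq_of_all_two (by decide +kernel) g row h

theorem act_reidemeister_two' (g) (row : List Pair) (h : row.length = 2) :
    act [⟨0, backslash, 0⟩, ⟨0, slash, 0⟩] g row = act [] g row :=
  act_eq_of_all_two (by decide +kernel) g row h

theorem act_pass_over (g) (row : List Pair) (h : row.length = 3) :
    act [⟨0, slash, 1⟩, ⟨1, slash, 0⟩, ⟨0, vertex, 1⟩] g row =
      act [⟨1, vertex, 0⟩, ⟨0, slash, 1⟩, ⟨1, slash, 0⟩] g row :=
  act_eq_of_all_three (by decide +kernel) g row h

theorem act_pass_under (g) (row : List Pair) (h : row.length = 3) :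
    act [⟨0, backslash, 1⟩, ⟨1, backslash, 0⟩, ⟨0, vertex, 1⟩] g row =
      act [⟨1, vertex, 0⟩, ⟨0, backslash, 1⟩, ⟨1, backslash, 0⟩] g row :=
  act_eq_of_all_three (by decide +kernel) g row h

/-- The companion of passing over a vertex: together they supply the nontrivial terms when one
crossing of Reidemeister move III is expanded. -/
theorem act_pass_capCup (g) (row : List Pair) (h : row.length = 3) :
    act [⟨0, slash, 1⟩, ⟨1, slash, 0⟩, ⟨0, cap, 1⟩, ⟨0, cup, 1⟩] g row =
      act [⟨1, cap, 0⟩, ⟨1, cup, 0⟩, ⟨0, slash, 1⟩, ⟨1, slash, 0⟩] g row :=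
  act_eq_of_all_three (by decide +kernel) g row h

theorem act_flip_vertex (g) (row : List Pair) (h : row.length = 2) :
    act [⟨0, vertex, 0⟩, ⟨0, slash, 0⟩] g row = act [⟨0, slash, 0⟩, ⟨0, vertex, 0⟩] g row :=
  act_eq_of_all_two (by decide +kernel) g row h

theorem act_kink (g) (row : List Pair) (h : row.length = 1) :
    act [⟨1, cup, 0⟩, ⟨0, slash, 1⟩, ⟨1, cap, 0⟩] g row = qVar ^ 5 * g row := by
  obtain ⟨x, rfl⟩ := List.length_eq_one_iff.1 h
  -- Exponents count powers of `qHalf`, so 10 stands for q⁵, the value of a.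
  have : (Pair.all.all fun x => sameSum (stackTerms [⟨1, cup, 0⟩, ⟨0, slash, 1⟩, ⟨1, cap, 0⟩] [x])
      [(([x], 10), 1)]) = true := by decide +kernel
  rw [← sumValue_stackTerms,
    sumValue_eq_of_sameSum (List.all_eq_true.1 this x x.mem_all)]
  rw [sumValue_cons, sumValue_nil]
  simp only [value, qVar, ← pow_mul]
  norm_num

theorem qVar_sub_inv_ne_zero : qVar - qVar⁻¹ ≠ 0 := by
  intro h
  have h1 : (RatFunc.X : RatFunc ℚ) ^ 4 = 1 := by
    have h2 : qVar * qVar = 1 := by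
      rw [sub_eq_zero] at h
      nth_rewrite 1 [h]
      exact inv_mul_cancel₀ qVar_ne_zero
    rw [← h2, qVar, qHalf]
    ring
  rw [← RatFunc.algebraMap_X, ← map_pow, ← map_one (algebraMap (Polynomial ℚ) (RatFunc ℚ))] at h1
  have h3 := congrArg Polynomial.natDegree (RatFunc.algebraMap_injective ℚ h1)
  simp at h3

/-- A circle with label z has weight q to the power `z.arc`, since its minimum and maximum
contribute equally. The six labels give q⁴ + q² + 2 + q⁻² + q⁻⁴, which is (q⁵ - q⁻⁵)/(q - q⁻¹) + 1.
-/
theorem act_circle (g) :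
    act [⟨0, cup, 0⟩, ⟨0, cap, 0⟩] g [] =
      ((qVar ^ 5 - (qVar ^ 5)⁻¹) * (qVar - qVar⁻¹)⁻¹ + 1) * g [] := by
  have h0 : sameSum (stackTerms [⟨0, cup, 0⟩, ⟨0, cap, 0⟩] [])
      [(([], 8), 1), (([], 4), 1), (([], 0), 2), (([], -4), 1), (([], -8), 1)] = true := by
    decide +kernel
  rw [← sumValue_stackTerms, sumValue_eq_of_sameSum h0]
  simp only [sumValue_cons, sumValue_nil, value]
  have h1 := qVar_sub_inv_ne_zero
  have h2 := qVar_ne_zero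
  have h3 : ∀ n : ℤ, qHalf ^ (2 * n) = qVar ^ n := fun n => by
    rw [qVar, zpow_mul]
    norm_cast
  have e1 : qHalf ^ (8 : ℤ) = qVar ^ (4 : ℤ) := by rw [← h3]; norm_num
  have e2 : qHalf ^ (4 : ℤ) = qVar ^ (2 : ℤ) := by rw [← h3]; norm_num
  have e3 : qHalf ^ (-4 : ℤ) = qVar ^ (-2 : ℤ) := by rw [← h3]; norm_num
  have e4 : qHalf ^ (-8 : ℤ) = qVar ^ (-4 : ℤ) := by rw [← h3]; norm_num
  rw [e1, e2, e3, e4]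
  have h4 : qVar ^ 5 - (qVar ^ 5)⁻¹ =
      (qVar ^ 4 + qVar ^ 2 + 1 + (qVar ^ 2)⁻¹ + (qVar ^ 4)⁻¹) * (qVar - qVar⁻¹) := by
    field_simp
    ring
  rw [h4, mul_assoc, mul_inv_cancel₀ h1]
  simp only [zpow_neg, zpow_zero]
  norm_cast
  ring

theorem act_capCup (g) (x y : Pair) :
    act [⟨0, cap, 0⟩, ⟨0, cup, 0⟩] g [x, y] = sumValue g (Pair.capCupTerms x y) := by
  rw [← sumValue_stackTerms]
  have : (Pair.all.all fun x => Pair.all.all fun y => sameSum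
      (stackTerms [⟨0, cap, 0⟩, ⟨0, cup, 0⟩] [x, y]) (Pair.capCupTerms x y)) = true := by
    decide +kernel
  exact sumValue_eq_of_sameSum
    (List.all_eq_true.1 (List.all_eq_true.1 this x x.mem_all) y y.mem_all) g

/-- True by construction: the crossing matrices were defined by solving the vertex relation for the
crossing. -/
theorem act_vertex_eq (c : ℤ) (p : KVPiece) (hp : p.bot = 2)
    (hp' : ∀ x y, p.terms [x, y] = Pair.crossingTerms c x y) (g) (row : List Pair)
    (h : row.length = 2) :
    act [⟨0, p, 0⟩] g row = - act [⟨0, vertex, 0⟩] g row + qHalf ^ c * g row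
      + qHalf ^ (-c) * act [⟨0, cap, 0⟩, ⟨0, cup, 0⟩] g row := by
  obtain ⟨x, y, rfl⟩ := List.length_eq_two.1 h
  have h2 (p : KVPiece) (hp : p.bot = 2) :
      act [⟨0, p, 0⟩] g [x, y] = sumValue g (p.terms [x, y]) := by
    simp only [act, terms, hp, sumValue_mapRow]
    simp
  rw [act_capCup, h2 p hp, h2 vertex rfl, hp', Pair.crossingTerms, sumValue_normalize, sumValue_append,
    sumValue_append, sumValue_scale, sumValue_scale, sumValue_cons, sumValue_nil]
  simp [value, KVPiece.terms]

end KVSlice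

/-! ### Reidemeister move III and invariance under all local moves -/

namespace KVSlice

open KVPiece RowTerm KnottedGraph

theorem act_slash (g) (row : List Pair) (h : row.length = 2) :
    act [⟨0, slash, 0⟩] g row = - act [⟨0, vertex, 0⟩] g row + qVar * g row
      + qVar⁻¹ * act [⟨0, cap, 0⟩, ⟨0, cup, 0⟩] g row :=
  act_vertex_eq 2 slash rfl (fun _ _ => rfl) g row h

theorem act_backslash (g) (row : List Pair) (h : row.length = 2) :
    act [⟨0, backslash, 0⟩] g row = - act [⟨0, vertex, 0⟩] g row + qVar⁻¹ * g row
      + qVar * act [⟨0, cap, 0⟩, ⟨0, cup, 0⟩] g row :=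
  act_vertex_eq (-2) backslash rfl (fun _ _ => rfl) g row h

instance decidableComposes :
    ∀ (b : ℕ) (w : List KVSlice) (b' : ℕ), Decidable (Composes src tgt b w b')
  | b, [], b' => inferInstanceAs (Decidable (b = b'))
  | b, s :: w, b' =>
    have := decidableComposes (tgt s) w b'
    inferInstanceAs (Decidable (src s = b ∧ Composes src tgt (tgt s) w b'))

theorem exists_append_append {l n r : ℕ} {row : List Pair} (h : row.length = l + n + r) :
    ∃ a b c : List Pair, row = a ++ b ++ c ∧ a.length = l ∧ b.length = n := by
  refine ⟨row.take l, (row.drop l).take n, row.drop (l + n), ?_, ?_, ?_⟩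
  · rw [List.append_assoc, ← List.drop_drop, List.take_append_drop, List.take_append_drop]
  all_goals simp; omega

/-- An identity between stacks persists if strands are added on both sides. -/
theorem act_widen_congr {n m m' : ℕ} {w w' : List KVSlice} (hw : Composes src tgt n w m)
    (hw' : Composes src tgt n w' m')
    (h : ∀ g row, row.length = n → act w g row = act w' g row) (l r : ℕ) (g) {row : List Pair}
    (hrow : row.length = l + n + r) :
    act (w.map (widen l r)) g row = act (w'.map (widen l r)) g row := by
  obtain ⟨a, b, c, rfl, ha, hb⟩ := exists_append_append hrow
  rw [act_widen hw l r g c ha hb, act_widen hw' l r g c ha hb, h _ _ hb]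

/-- A crossing is a combination of a vertex, two vertical strands and a maximum followed by a
minimum. Expanding the crossing of the two lower strands in this way leaves a strand that passes
over each of the three, and the corresponding terms on both sides agree. -/
theorem act_reidemeister_three (g) (row : List Pair) (h : row.length = 3) :
    act [⟨0, slash, 1⟩, ⟨1, slash, 0⟩, ⟨0, slash, 1⟩] g row =
      act [⟨1, slash, 0⟩, ⟨0, slash, 1⟩, ⟨1, slash, 0⟩] g row := by
  have hA : ∀ g (row : List Pair), row.length = 3 → act [⟨0, slash, 1⟩] g row =
      (-1) * act [⟨0, vertex, 1⟩] g row + (qVar * g row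
        + qVar⁻¹ * act [⟨0, cap, 1⟩, ⟨0, cup, 1⟩] g row) := by
    intro g row hrow
    obtain ⟨x, y, z, rfl⟩ := List.length_eq_three.1 hrow
    have h1 := act_slash (fun t => g (t ++ [z])) [x, y] rfl
    have hw (p : KVPiece) (hp : p.bot = 2) : act [⟨0, p, 0⟩] (fun t => g (t ++ [z])) [x, y] =
        act [⟨0, p, 1⟩] g [x, y, z] :=
      (act_widen (w := [⟨0, p, 0⟩]) (n := 2) (m := p.top) (by simp [Composes, src, tgt, hp]) 0 1 g
        (a := []) (b := [x, y]) [z] rfl rfl).symm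
    have hw' : act [⟨0, cap, 0⟩, ⟨0, cup, 0⟩] (fun t => g (t ++ [z])) [x, y] =
        act [⟨0, cap, 1⟩, ⟨0, cup, 1⟩] g [x, y, z] :=
      (act_widen (w := [⟨0, cap, 0⟩, ⟨0, cup, 0⟩]) (n := 2) (m := 2) ⟨rfl, rfl, rfl⟩ 0 1 g
        (a := []) (b := [x, y]) [z] rfl rfl).symm
    rw [hw _ rfl, hw _ rfl, hw'] at h1
    rw [h1]
    simp only [List.cons_append, List.nil_append]
    ring
  have hB : ∀ g (row : List Pair), row.length = 3 → act [⟨1, slash, 0⟩] g row =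
      (-1) * act [⟨1, vertex, 0⟩] g row + (qVar * g row
        + qVar⁻¹ * act [⟨1, cap, 0⟩, ⟨1, cup, 0⟩] g row) := by
    intro g row hrow
    obtain ⟨x, y, z, rfl⟩ := List.length_eq_three.1 hrow
    have h1 := act_slash (fun t => g ([x] ++ t ++ [])) [y, z] rfl
    have hw (p : KVPiece) (hp : p.bot = 2) : act [⟨0, p, 0⟩] (fun t => g ([x] ++ t ++ [])) [y, z] =
        act [⟨1, p, 0⟩] g [x, y, z] :=
      (act_widen (w := [⟨0, p, 0⟩]) (n := 2) (m := p.top) (by simp [Composes, src, tgt, hp]) 1 0 g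
        (a := [x]) (b := [y, z]) [] rfl rfl).symm
    have hw' : act [⟨0, cap, 0⟩, ⟨0, cup, 0⟩] (fun t => g ([x] ++ t ++ [])) [y, z] =
        act [⟨1, cap, 0⟩, ⟨1, cup, 0⟩] g [x, y, z] :=
      (act_widen (w := [⟨0, cap, 0⟩, ⟨0, cup, 0⟩]) (n := 2) (m := 2) ⟨rfl, rfl, rfl⟩ 1 0 g
        (a := [x]) (b := [y, z]) [] rfl rfl).symm
    rw [hw _ rfl, hw _ rfl, hw'] at h1
    rw [h1]
    simp only [List.cons_append, List.nil_append]
    ring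
  -- On the left-hand side the topmost crossing is expanded; linearity of the action moves the
  -- combination below the other two.
  have h3 : act [⟨0, slash, 1⟩, ⟨1, slash, 0⟩, ⟨0, slash, 1⟩] g row =
      (-1) * act [⟨0, slash, 1⟩, ⟨1, slash, 0⟩, ⟨0, vertex, 1⟩] g row +
        (qVar * act [⟨0, slash, 1⟩, ⟨1, slash, 0⟩] g row + qVar⁻¹ *
          act [⟨0, slash, 1⟩, ⟨1, slash, 0⟩, ⟨0, cap, 1⟩, ⟨0, cup, 1⟩] g row) := by
    have e (w) : act ([⟨0, slash, 1⟩, ⟨1, slash, 0⟩] ++ w) g row =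
        act [⟨0, slash, 1⟩, ⟨1, slash, 0⟩] (act w g) row := by rw [act_append]
    have e1 := e [⟨0, slash, 1⟩]
    have e2 := e [⟨0, vertex, 1⟩]
    have e3 := e [⟨0, cap, 1⟩, ⟨0, cup, 1⟩]
    simp only [List.cons_append, List.nil_append] at e1 e2 e3
    rw [e1, e2, e3, ← act_mul, ← act_mul, ← act_mul, ← act_add, ← act_add]
    exact act_congr (w := [⟨0, slash, 1⟩, ⟨1, slash, 0⟩]) (n := 3) (m := 3) ⟨rfl, rfl, rfl⟩
      (fun row hrow => hA g row hrow) h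
  -- On the right-hand side it is the lowest crossing that is expanded, so the other two are
  -- absorbed into the function.
  have h4 := hB (act [⟨0, slash, 1⟩, ⟨1, slash, 0⟩] g) row h
  simp only [← act_append, List.cons_append, List.nil_append] at h4
  rw [h3, h4, act_pass_over g row h, act_pass_capCup g row h]

/-- The two pieces act on disjoint blocks of the row, so both sides are the same double sum in
different order. -/
theorem act_exchange (l m r : ℕ) (x y : KVPiece) (g) {row : List Pair}
    (hrow : row.length = l + x.bot + m + y.bot + r) :
    act [⟨l, x, m + y.bot + r⟩, ⟨l + x.top + m, y, r⟩] g row =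
      act [⟨l + x.bot + m, y, r⟩, ⟨l, x, m + y.top + r⟩] g row := by
  obtain ⟨a, b, c, d, e, rfl, ha, hb, hc, hd⟩ : ∃ a b c d e : List Pair,
      row = a ++ (b ++ (c ++ (d ++ e))) ∧ a.length = l ∧ b.length = x.bot ∧ c.length = m ∧
        d.length = y.bot := by
    refine ⟨row.take l, (row.drop l).take x.bot, (row.drop (l + x.bot)).take m,
      (row.drop (l + x.bot + m)).take y.bot, row.drop (l + x.bot + m + y.bot), ?_, ?_, ?_, ?_, ?_⟩
    · simp only [← List.drop_drop, List.take_append_drop]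
    all_goals simp; omega
  have h1 : act [⟨l, x, m + y.bot + r⟩, ⟨l + x.top + m, y, r⟩] g (a ++ (b ++ (c ++ (d ++ e)))) =
      sumValue (fun s => sumValue (fun t => g (a ++ s ++ c ++ t ++ e)) (y.terms d))
        (x.terms b) := by
    rw [show a ++ (b ++ (c ++ (d ++ e))) = a ++ b ++ (c ++ d ++ e) by simp, act,
      terms_eq _ _ _ _ _ _ ha hb, sumValue_mapRow]
    refine sumValue_congr fun s hs => ?_
    rw [show a ++ s.1.1 ++ (c ++ d ++ e) = (a ++ s.1.1 ++ c) ++ d ++ e by simp, act,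
      terms_eq _ _ _ _ _ _ (by simp [ha, hc, length_of_mem_pieceTerms hs hb, add_assoc]) hd,
      sumValue_mapRow]
    rfl
  have h2 : act [⟨l + x.bot + m, y, r⟩, ⟨l, x, m + y.top + r⟩] g (a ++ (b ++ (c ++ (d ++ e)))) =
      sumValue (fun t => sumValue (fun s => g (a ++ s ++ c ++ t ++ e)) (x.terms b))
        (y.terms d) := by
    rw [show a ++ (b ++ (c ++ (d ++ e))) = (a ++ b ++ c) ++ d ++ e by simp, act,
      terms_eq _ _ _ _ _ _ (by simp [ha, hb, hc, add_assoc]) hd, sumValue_mapRow]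
    refine sumValue_congr fun t ht => ?_
    rw [show a ++ b ++ c ++ t.1.1 ++ e = a ++ b ++ (c ++ t.1.1 ++ e) by simp, act,
      terms_eq _ _ _ _ _ _ ha hb, sumValue_mapRow]
    simp [act]
  rw [h1, h2, sumValue_comm]

theorem act_localMove {w w' : List KVSlice} (h : LocalMove w w') {n m : ℕ}
    (hw : Composes src tgt n w m) (g) {row : List Pair} (hrow : row.length = n) :
    act w g row = act w' g row := by
  subst hrow
  cases h with
  | exchange l k r x y =>
    refine act_exchange l k r x y g ?_
    have := hw.1
    simp only [src] at this
    omega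
  | zigzag_left l r =>
    exact act_widen_congr (w := [⟨0, cup, 1⟩, ⟨1, cap, 0⟩])
      (w' := []) (n := 1) (m := 1) (m' := 1) (by decide)
      (by decide) act_zigzag_left l r g (by have := hw.1; simp only [src, bot] at this; omega)
  | zigzag_right l r =>
    exact act_widen_congr (w := [⟨1, cup, 0⟩, ⟨0, cap, 1⟩])
      (w' := []) (n := 1) (m := 1) (m' := 1) (by decide)
      (by decide) act_zigzag_right l r g (by have := hw.1; simp only [src, bot] at this; omega)
  | cup_slash l r =>
    exact act_widen_congr (w := [⟨0, cup, 1⟩, ⟨1, slash, 0⟩])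
      (w' := [⟨1, cup, 0⟩, ⟨0, backslash, 1⟩]) (n := 1) (m := 3) (m' := 3) (by decide)
      (by decide) act_cup_slash l r g (by have := hw.1; simp only [src, bot] at this; omega)
  | cup_backslash l r =>
    exact act_widen_congr (w := [⟨0, cup, 1⟩, ⟨1, backslash, 0⟩])
      (w' := [⟨1, cup, 0⟩, ⟨0, slash, 1⟩]) (n := 1) (m := 3) (m' := 3) (by decide)
      (by decide) act_cup_backslash l r g (by have := hw.1; simp only [src, bot] at this; omega)
  | cup_vertex l r =>
    exact act_widen_congr (w := [⟨0, cup, 1⟩, ⟨1, vertex, 0⟩])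
      (w' := [⟨1, cup, 0⟩, ⟨0, vertex, 1⟩]) (n := 1) (m := 3) (m' := 3) (by decide)
      (by decide) act_cup_vertex l r g (by have := hw.1; simp only [src, bot] at this; omega)
  | slash_cap l r =>
    exact act_widen_congr (w := [⟨1, slash, 0⟩, ⟨0, cap, 1⟩])
      (w' := [⟨0, backslash, 1⟩, ⟨1, cap, 0⟩]) (n := 3) (m := 1) (m' := 1) (by decide)
      (by decide) act_slash_cap l r g (by have := hw.1; simp only [src, bot] at this; omega)
  | backslash_cap l r =>
    exact act_widen_congr (w := [⟨1, backslash, 0⟩, ⟨0, cap, 1⟩])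
      (w' := [⟨0, slash, 1⟩, ⟨1, cap, 0⟩]) (n := 3) (m := 1) (m' := 1) (by decide)
      (by decide) act_backslash_cap l r g (by have := hw.1; simp only [src, bot] at this; omega)
  | vertex_cap l r =>
    exact act_widen_congr (w := [⟨1, vertex, 0⟩, ⟨0, cap, 1⟩])
      (w' := [⟨0, vertex, 1⟩, ⟨1, cap, 0⟩]) (n := 3) (m := 1) (m' := 1) (by decide)
      (by decide) act_vertex_cap l r g (by have := hw.1; simp only [src, bot] at this; omega)
  | reidemeister_two l r =>
    exact act_widen_congr (w := [⟨0, slash, 0⟩, ⟨0, backslash, 0⟩])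
      (w' := []) (n := 2) (m := 2) (m' := 2) (by decide)
      (by decide) act_reidemeister_two l r g (by have := hw.1; simp only [src, bot] at this; omega)
  | reidemeister_two' l r =>
    exact act_widen_congr (w := [⟨0, backslash, 0⟩, ⟨0, slash, 0⟩])
      (w' := []) (n := 2) (m := 2) (m' := 2) (by decide)
      (by decide) act_reidemeister_two' l r g (by have := hw.1; simp only [src, bot] at this; omega)
  | reidemeister_three l r =>
    exact act_widen_congr (w := [⟨0, slash, 1⟩, ⟨1, slash, 0⟩, ⟨0, slash, 1⟩])
      (w' := [⟨1, slash, 0⟩, ⟨0, slash, 1⟩, ⟨1, slash, 0⟩]) (n := 3) (m := 3) (m' := 3) (by decide)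
      (by decide) act_reidemeister_three l r g (by have := hw.1; simp only [src, bot] at this; omega)
  | pass_over l r =>
    exact act_widen_congr (w := [⟨0, slash, 1⟩, ⟨1, slash, 0⟩, ⟨0, vertex, 1⟩])
      (w' := [⟨1, vertex, 0⟩, ⟨0, slash, 1⟩, ⟨1, slash, 0⟩]) (n := 3) (m := 3) (m' := 3) (by decide)
      (by decide) act_pass_over l r g (by have := hw.1; simp only [src, bot] at this; omega)
  | pass_under l r =>
    exact act_widen_congr (w := [⟨0, backslash, 1⟩, ⟨1, backslash, 0⟩, ⟨0, vertex, 1⟩])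
      (w' := [⟨1, vertex, 0⟩, ⟨0, backslash, 1⟩, ⟨1, backslash, 0⟩]) (n := 3) (m := 3) (m' := 3) (by decide)
      (by decide) act_pass_under l r g (by have := hw.1; simp only [src, bot] at this; omega)
  | flip_vertex l r =>
    exact act_widen_congr (w := [⟨0, vertex, 0⟩, ⟨0, slash, 0⟩])
      (w' := [⟨0, slash, 0⟩, ⟨0, vertex, 0⟩]) (n := 2) (m := 2) (m' := 2) (by decide)
      (by decide) act_flip_vertex l r g (by have := hw.1; simp only [src, bot] at this; omega)

end KVSlice

/-! ### The skein relations with idle strands added -/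

namespace KVSlice

open KVPiece

theorem act_widen_vertex_eq (x y : QField) (p : KVPiece) (hp : p.bot = 2)
    (h : ∀ g (row : List Pair), row.length = 2 →
      act [⟨0, p, 0⟩] g row = - act [⟨0, vertex, 0⟩] g row + x * g row
        + y * act [⟨0, cap, 0⟩, ⟨0, cup, 0⟩] g row) (l r : ℕ) (g) {row : List Pair}
    (hrow : row.length = l + 2 + r) :
    act [⟨l, p, r⟩] g row = - act [⟨l, vertex, r⟩] g row + x * g row
        + y * act [⟨l, cap, r⟩, ⟨l, cup, r⟩] g row := by
  obtain ⟨a, b, c, rfl, ha, hb⟩ := exists_append_append hrow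
  have h1 := h (fun t => g (a ++ t ++ c)) b hb
  have hw (p : KVPiece) (hp : p.bot = 2) := act_widen (w := [⟨0, p, 0⟩]) (n := 2) (m := p.top)
    (by simp [Composes, src, tgt, hp]) l r g c ha hb
  rw [← hw p hp, ← hw vertex rfl, ← act_widen (w := [⟨0, cap, 0⟩, ⟨0, cup, 0⟩]) (m := 2)
    ⟨rfl, rfl, rfl⟩ l r g c ha hb] at h1
  exact h1

theorem act_widen_kink (l r : ℕ) (g) {row : List Pair} (hrow : row.length = l + 1 + r) :
    act [⟨l + 1, cup, r⟩, ⟨l, slash, r + 1⟩, ⟨l + 1, cap, r⟩] g row = qVar ^ 5 * g row := by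
  obtain ⟨a, b, c, rfl, ha, hb⟩ := exists_append_append hrow
  rw [← act_kink (fun t => g (a ++ t ++ c)) b hb, ← act_widen (m := 1) (by decide) l r g c ha hb]
  rfl

theorem act_widen_circle (l r : ℕ) (g) {row : List Pair} (hrow : row.length = l + r) :
    act [⟨l, cup, r⟩, ⟨l, cap, r⟩] g row =
      ((qVar ^ 5 - (qVar ^ 5)⁻¹) * (qVar - qVar⁻¹)⁻¹ + 1) * g row := by
  obtain ⟨a, b, c, rfl, ha, hb⟩ := exists_append_append (l := l) (n := 0) hrow
  obtain rfl := List.length_eq_zero_iff.1 hb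
  rw [← act_circle (fun t => g (a ++ t ++ c)), ← act_widen (m := 0) (by decide) l r g c ha hb]
  rfl

end KVSlice

/-! ### The vertex model as a functional on the skein module at a = q⁵ -/

namespace KnottedGraph

open KVSlice KVPiece

/-- The value of the vertex model at a closed diagram. -/
noncomputable def vertexModel (D : KnottedGraph) : QField := act D.word (fun _ => 1) []

theorem _root_.Composes.of_append {σ β : Type} {src tgt : σ → β} {w w' : List σ} {b b'' : β}
    (h : Composes src tgt b (w ++ w') b'') :
    ∃ b', Composes src tgt b w b' ∧ Composes src tgt b' w' b'' := by
  induction w generalizing b with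
  | nil => exact ⟨b, rfl, h⟩
  | cons s w ih =>
    obtain ⟨b', h1, h2⟩ := ih h.2
    exact ⟨b', ⟨h.1, h1⟩, h2⟩

theorem IsStack.composes {D : KnottedGraph} {below w above : List KVSlice}
    (h : D.IsStack below w above) :
    ∃ n m, Composes src tgt 0 below n ∧ Composes src tgt n w m ∧ Composes src tgt m above 0 := by
  have h1 := D.closed
  rw [h] at h1
  obtain ⟨m, h2, h3⟩ := h1.of_append
  obtain ⟨n, h4, h5⟩ := h2.of_append
  exact ⟨n, m, h4, h5, h3⟩

theorem IsStack.vertexModel_eq {D : KnottedGraph} {below w above : List KVSlice}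
    (h : D.IsStack below w above) :
    D.vertexModel = act below (act w (act above fun _ => 1)) [] := by
  rw [vertexModel, h, act_append, act_append]

/-- The specialization `a = q⁵`. -/
noncomputable def specialize : QARing →+* QField :=
  LaurentPolynomial.eval₂ (RingHom.id QField) (Units.mk0 qVar qVar_ne_zero ^ (((6 : ℕ) : ℤ) - 1))

theorem specialize_q : specialize q = qVar := by
  simp [specialize, q]

theorem specialize_qInv : specialize qInv = qVar⁻¹ := by
  simp [specialize, qInv]

theorem specialize_a : specialize a = qVar ^ 5 := by
  simp [specialize, a]

theorem specialize_loopValue :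
    specialize loopValue = (qVar ^ 5 - (qVar ^ 5)⁻¹) * (qVar - qVar⁻¹)⁻¹ + 1 := by
  have h1 : specialize aInv = (qVar ^ 5)⁻¹ := by
    simp [specialize, aInv]
  rw [loopValue, map_add, map_mul, map_sub, specialize_a, h1, map_one]
  simp [specialize]

/-- The additive extension of the vertex model to formal combinations of diagrams. -/
noncomputable def modelSum : (KnottedGraph →₀ QARing) →+ QField :=
  Finsupp.liftAddHom fun D =>
    (AddMonoidHom.mulRight D.vertexModel).comp specialize.toAddMonoidHom

theorem modelSum_single (D : KnottedGraph) (c : QARing) :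
    modelSum (Finsupp.single D c) = specialize c * D.vertexModel := by
  simp [modelSum]

/-- The functional is semilinear along the specialization. Vanishing on the relations therefore
extends to their span over the two-variable ring. -/
theorem modelSum_smul (c : QARing) (x : KnottedGraph →₀ QARing) :
    modelSum (c • x) = specialize c * modelSum x := by
  induction x using Finsupp.induction_linear with
  | zero => simp
  | add x y hx hy => rw [smul_add, map_add, hx, hy, map_add, mul_add]
  | single D d =>
    rw [Finsupp.smul_single, modelSum_single, modelSum_single, smul_eq_mul, map_mul, mul_assoc]

theorem act_eq_combination {n m : ℕ} {below : List KVSlice} (hb : Composes src tgt n below m)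
    {g g₁ g₂ g₃ : List Pair → QField} {x y z : QField}
    (h : ∀ row, row.length = m → g row = x * g₁ row + y * g₂ row + z * g₃ row) {row : List Pair}
    (hrow : row.length = n) :
    act below g row = x * act below g₁ row + y * act below g₂ row + z * act below g₃ row := by
  rw [act_congr hb h hrow, act_add, act_add, act_mul, act_mul, act_mul]

theorem vertexModel_vertex {below above : List KVSlice} {l r : ℕ} {D D' D₃ D₄ : KnottedGraph}
    {p : KVPiece} (x y : QField) (hp : p.bot = 2)
    (hpx : ∀ g (row : List Pair), row.length = 2 →
      act [⟨0, p, 0⟩] g row = - act [⟨0, vertex, 0⟩] g row + x * g row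
        + y * act [⟨0, cap, 0⟩, ⟨0, cup, 0⟩] g row)
    (h : D.IsStack below [⟨l, vertex, r⟩] above)
    (h' : D'.IsStack below [⟨l, p, r⟩] above)
    (h₃ : D₃.IsStack below [] above)
    (h₄ : D₄.IsStack below [⟨l, cap, r⟩, ⟨l, cup, r⟩] above) :
    D.vertexModel = -1 * D'.vertexModel + x * D₃.vertexModel + y * D₄.vertexModel := by
  obtain ⟨n, m, hb, hw, -⟩ := h.composes
  rw [h.vertexModel_eq, h'.vertexModel_eq, h₃.vertexModel_eq, h₄.vertexModel_eq]
  refine act_eq_combination hb (fun row hrow => ?_) rfl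
  rw [act_widen_vertex_eq x y p hp hpx l r _ (hrow.trans hw.1.symm)]
  simp only [act]
  ring

/-- Every relation has been checked as an identity of actions that holds for an arbitrary function
above it; the stack below preserves it by linearity. The crossing relation is the difference of the
two vertex relations. -/
theorem modelSum_eq_zero {x : KnottedGraph →₀ QARing} (hx : SkeinRelation x) : modelSum x = 0 := by
  cases hx with
  | isotopy below above w w' D D' h hD hD' =>
    obtain ⟨n, m, hb, hw, -⟩ := hD.composes
    rw [map_sub, modelSum_single, modelSum_single, hD.vertexModel_eq, hD'.vertexModel_eq,
      act_congr hb (fun row hrow => act_localMove h hw _ hrow) rfl, sub_self]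
  | circle below above l r D D' hD hD' =>
    obtain ⟨n, m, hb, hw, -⟩ := hD.composes
    rw [map_sub, modelSum_smul, modelSum_single, modelSum_single, hD.vertexModel_eq,
      hD'.vertexModel_eq, act_congr hb (fun row hrow => act_widen_circle l r _
        (hrow.trans hw.1.symm)) rfl, act_mul, specialize_loopValue, map_one]
    simp only [act, one_mul, sub_self]
  | crossing below above l r D₁ D₂ D₃ D₄ h₁ h₂ h₃ h₄ =>
    obtain ⟨n, m, hb, hw, -⟩ := h₁.composes
    have key : D₁.vertexModel = 1 * D₂.vertexModel + (qVar - qVar⁻¹) * D₃.vertexModel +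
        (qVar⁻¹ - qVar) * D₄.vertexModel := by
      rw [h₁.vertexModel_eq, h₂.vertexModel_eq, h₃.vertexModel_eq, h₄.vertexModel_eq]
      refine act_eq_combination hb (fun row hrow => ?_) rfl
      rw [act_widen_vertex_eq _ _ slash rfl act_slash l r _ (hrow.trans hw.1.symm),
        act_widen_vertex_eq _ _ backslash rfl act_backslash l r _ (hrow.trans hw.1.symm)]
      simp only [act]
      ring
    simp only [map_sub, modelSum_smul, modelSum_single, specialize_q, specialize_qInv, map_one, key]
    ring
  | kink below above l r D D' hD hD' =>
    obtain ⟨n, m, hb, hw, -⟩ := hD.composes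
    rw [map_sub, modelSum_smul, modelSum_single, modelSum_single, hD.vertexModel_eq,
      hD'.vertexModel_eq, act_congr hb (fun row hrow => act_widen_kink l r _
        (hrow.trans hw.1.symm)) rfl, act_mul, specialize_a, map_one]
    simp only [act, one_mul, sub_self]
  | vertex_slash below above l r D D₁ D₃ D₄ h h₁ h₃ h₄ =>
    simp only [map_sub, map_add, map_neg, modelSum_smul, modelSum_single, specialize_q,
      specialize_qInv, map_one, vertexModel_vertex _ _ rfl act_slash h h₁ h₃ h₄]
    ring
  | vertex_backslash below above l r D D₂ D₃ D₄ h h₂ h₃ h₄ =>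
    simp only [map_sub, map_add, map_neg, modelSum_smul, modelSum_single, specialize_q,
      specialize_qInv, map_one, vertexModel_vertex _ _ rfl act_backslash h h₂ h₃ h₄]
    ring

/-- This is the uniqueness that the theorem needs: whichever value the relations produce, its
specialization is determined by the model, which equals 1 at the empty diagram. -/
theorem IsKauffmanVogel.specialize_eq {D : KnottedGraph} {p : QARing} (h : D.IsKauffmanVogel p) :
    specialize p = D.vertexModel := by
  have h1 : modelSum (Finsupp.single D 1 - p • Finsupp.single empty 1) = 0 := by
    refine Submodule.span_induction (p := fun x _ => modelSum x = 0) (fun x hx =>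
      modelSum_eq_zero hx) (map_zero _) (fun x y _ _ hx hy => ?_) (fun c x _ hx => ?_) h
    · rw [map_add, hx, hy, add_zero]
    · rw [modelSum_smul, hx, mul_zero]
  rw [map_sub, modelSum_smul, modelSum_single, modelSum_single, map_one, one_mul, one_mul,
    sub_eq_zero] at h1
  rw [h1]
  simp [vertexModel, empty, act]

end KnottedGraph

/-! ## Reduction of diagrams to multiples of the empty diagram -/

namespace KnottedGraph

open KVPiece KVSlice

/-- The skein module: formal combinations of closed diagrams modulo the defining relations. -/
abbrev SkeinModule : Type :=
  (KnottedGraph →₀ QARing) ⧸ Submodule.span QARing {x : KnottedGraph →₀ QARing | SkeinRelation x}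

open Classical in
/-- The class of a stack of slices in the skein module, `0` if the stack is not a closed diagram. -/
noncomputable def stackClass (w : List KVSlice) : SkeinModule :=
  if h : Composes src tgt 0 w 0 then Submodule.Quotient.mk (Finsupp.single ⟨w, h⟩ 1) else 0

theorem composes_append_iff {n m k : ℕ} {w w' : List KVSlice} (h : Composes src tgt n w m) :
    Composes src tgt n (w ++ w') k ↔ Composes src tgt m w' k := by
  induction w generalizing n with
  | nil => rw [show n = m from h]; rfl
  | cons s w ih =>
    rw [List.cons_append, Composes, ih h.2]
    exact and_iff_right h.1

theorem composes_nil (n : ℕ) : Composes src tgt n [] n := rfl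

theorem stackClass_of_composes {w : List KVSlice} (h : Composes src tgt 0 w 0) :
    stackClass w = Submodule.Quotient.mk (Finsupp.single ⟨w, h⟩ 1) := dif_pos h

theorem stackClass_of_not_composes {w : List KVSlice} (h : ¬ Composes src tgt 0 w 0) :
    stackClass w = 0 := dif_neg h

theorem mk_eq_zero_of_skeinRelation {x : KnottedGraph →₀ QARing} (h : SkeinRelation x) :
    (Submodule.Quotient.mk x : SkeinModule) = 0 :=
  (Submodule.Quotient.mk_eq_zero _).2 (Submodule.subset_span h)

section Relations

variable {below above w w' : List KVSlice} {n m l r : ℕ}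

/-- Nothing is required of `above`: if it does not fit, neither stack is a closed diagram and both
classes are 0. This is what allows relations to be stated for half diagrams with all continuations
at once. -/
theorem stackClass_isotopy (hb : Composes src tgt 0 below n) (hw : Composes src tgt n w m)
    (hw' : Composes src tgt n w' m) (h : LocalMove w w') :
    stackClass (below ++ w ++ above) = stackClass (below ++ w' ++ above) := by
  have e : Composes src tgt 0 (below ++ w ++ above) 0 ↔
      Composes src tgt 0 (below ++ w' ++ above) 0 := by
    rw [composes_append_iff (hb.append hw), composes_append_iff (hb.append hw')]
  by_cases h1 : Composes src tgt 0 (below ++ w ++ above) 0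
  · rw [stackClass_of_composes h1, stackClass_of_composes (e.1 h1), ← sub_eq_zero]
    exact mk_eq_zero_of_skeinRelation (.isotopy below above w w' _ _ h rfl rfl)
  · rw [stackClass_of_not_composes h1, stackClass_of_not_composes (mt e.2 h1)]

theorem stackClass_circle (hb : Composes src tgt 0 below (l + r)) :
    stackClass (below ++ [⟨l, cup, r⟩, ⟨l, cap, r⟩] ++ above) =
      loopValue • stackClass (below ++ [] ++ above) := by
  have hw : Composes src tgt (l + r) [⟨l, cup, r⟩, ⟨l, cap, r⟩] (l + r) := by
    simp [Composes, src, tgt, bot, top]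
  have e : Composes src tgt 0 (below ++ [⟨l, cup, r⟩, ⟨l, cap, r⟩] ++ above) 0 ↔
      Composes src tgt 0 (below ++ [] ++ above) 0 := by
    rw [composes_append_iff (hb.append hw), composes_append_iff (hb.append (composes_nil _))]
  by_cases h1 : Composes src tgt 0 (below ++ [⟨l, cup, r⟩, ⟨l, cap, r⟩] ++ above) 0
  · rw [stackClass_of_composes h1, stackClass_of_composes (e.1 h1), ← sub_eq_zero]
    exact mk_eq_zero_of_skeinRelation (.circle below above l r _ _ rfl rfl)
  · rw [stackClass_of_not_composes h1, stackClass_of_not_composes (mt e.2 h1), smul_zero]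

theorem stackClass_kink (hb : Composes src tgt 0 below (l + 1 + r)) :
    stackClass (below ++ [⟨l + 1, cup, r⟩, ⟨l, slash, r + 1⟩, ⟨l + 1, cap, r⟩] ++ above) =
      a • stackClass (below ++ [] ++ above) := by
  have hw : Composes src tgt (l + 1 + r)
      [⟨l + 1, cup, r⟩, ⟨l, slash, r + 1⟩, ⟨l + 1, cap, r⟩] (l + 1 + r) := by
    simp [Composes, src, tgt, bot, top]
    omega
  have e : Composes src tgt 0
        (below ++ [⟨l + 1, cup, r⟩, ⟨l, slash, r + 1⟩, ⟨l + 1, cap, r⟩] ++ above) 0 ↔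
      Composes src tgt 0 (below ++ [] ++ above) 0 := by
    rw [composes_append_iff (hb.append hw), composes_append_iff (hb.append (composes_nil _))]
  by_cases h1 : Composes src tgt 0
      (below ++ [⟨l + 1, cup, r⟩, ⟨l, slash, r + 1⟩, ⟨l + 1, cap, r⟩] ++ above) 0
  · rw [stackClass_of_composes h1, stackClass_of_composes (e.1 h1), ← sub_eq_zero]
    exact mk_eq_zero_of_skeinRelation (.kink below above l r _ _ rfl rfl)
  · rw [stackClass_of_not_composes h1, stackClass_of_not_composes (mt e.2 h1), smul_zero]

theorem composes_piece (l r : ℕ) {p : KVPiece} (hb : p.bot = 2) (ht : p.top = 2) :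
    Composes src tgt (l + 2 + r) [⟨l, p, r⟩] (l + 2 + r) := by
  simp [Composes, src, tgt, hb, ht]

theorem composes_capCup (l r : ℕ) :
    Composes src tgt (l + 2 + r) [⟨l, cap, r⟩, ⟨l, cup, r⟩] (l + 2 + r) := by
  simp [Composes, src, tgt, bot, top]

theorem stackClass_crossing (hb : Composes src tgt 0 below (l + 2 + r)) :
    stackClass (below ++ [⟨l, slash, r⟩] ++ above) =
      stackClass (below ++ [⟨l, backslash, r⟩] ++ above) + (q - qInv) •
        (stackClass (below ++ [] ++ above) -
          stackClass (below ++ [⟨l, cap, r⟩, ⟨l, cup, r⟩] ++ above)) := by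
  by_cases h : Composes src tgt (l + 2 + r) above 0
  · rw [stackClass_of_composes ((hb.append (composes_piece l r rfl rfl)).append h),
      stackClass_of_composes ((hb.append (composes_piece l r rfl rfl)).append h),
      stackClass_of_composes ((hb.append (composes_capCup l r)).append h),
      stackClass_of_composes ((hb.append (composes_nil _)).append h), ← sub_eq_zero, ← sub_sub]
    exact mk_eq_zero_of_skeinRelation (.crossing below above l r _ _ _ _ rfl rfl rfl rfl)
  · rw [stackClass_of_not_composes (mt (composes_append_iff
        (hb.append (composes_piece l r rfl rfl))).1 h),
      stackClass_of_not_composes (mt (composes_append_iff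
        (hb.append (composes_piece l r rfl rfl))).1 h),
      stackClass_of_not_composes (mt (composes_append_iff
        (hb.append (composes_capCup l r))).1 h),
      stackClass_of_not_composes (mt (composes_append_iff (hb.append (composes_nil _))).1 h)]
    simp

theorem stackClass_vertex (hb : Composes src tgt 0 below (l + 2 + r)) :
    stackClass (below ++ [⟨l, vertex, r⟩] ++ above) =
      -stackClass (below ++ [⟨l, slash, r⟩] ++ above) + q • stackClass (below ++ [] ++ above) +
        qInv • stackClass (below ++ [⟨l, cap, r⟩, ⟨l, cup, r⟩] ++ above) := by
  by_cases h : Composes src tgt (l + 2 + r) above 0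
  · rw [stackClass_of_composes ((hb.append (composes_piece l r rfl rfl)).append h),
      stackClass_of_composes ((hb.append (composes_piece l r rfl rfl)).append h),
      stackClass_of_composes ((hb.append (composes_capCup l r)).append h),
      stackClass_of_composes ((hb.append (composes_nil _)).append h), ← sub_eq_zero]
    exact mk_eq_zero_of_skeinRelation (.vertex_slash below above l r _ _ _ _ rfl rfl rfl rfl)
  · rw [stackClass_of_not_composes (mt (composes_append_iff
        (hb.append (composes_piece l r rfl rfl))).1 h),
      stackClass_of_not_composes (mt (composes_append_iff
        (hb.append (composes_piece l r rfl rfl))).1 h),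
      stackClass_of_not_composes (mt (composes_append_iff
        (hb.append (composes_capCup l r))).1 h),
      stackClass_of_not_composes (mt (composes_append_iff (hb.append (composes_nil _))).1 h)]
    simp

end Relations

/-! ### Half diagrams and the operators that put pieces on them -/

/-- The stack of slices over `n` strands with given pieces at given positions. -/
def realize : ℕ → List (ℕ × KVPiece) → List KVSlice
  | _, [] => []
  | n, (l, p) :: w => ⟨l, p, n - (l + p.bot)⟩ :: realize (l + p.top + (n - (l + p.bot))) w

theorem realize_append {n m : ℕ} {w w' : List (ℕ × KVPiece)}
    (h : Composes src tgt n (realize n w) m) :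
    realize n (w ++ w') = realize n w ++ realize m w' := by
  induction w generalizing n with
  | nil => rw [show n = m from h]; rfl
  | cons s w ih =>
    rw [List.cons_append, realize, realize, List.cons_append]
    exact congrArg _ (ih h.2)

theorem exists_realize {n m : ℕ} {w : List KVSlice} (h : Composes src tgt n w m) :
    ∃ u, realize n u = w := by
  induction w generalizing n with
  | nil => exact ⟨[], rfl⟩
  | cons s w ih =>
    obtain ⟨h1, h2⟩ := h
    obtain ⟨u, hu⟩ := ih h2
    obtain ⟨l, p, r⟩ := s
    have h3 : n - (l + p.bot) = r := by simp only [src] at h1; omega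
    refine ⟨(l, p) :: u, ?_⟩
    rw [realize, h3, show realize (l + p.top + r) u = w from hu]

/-- Functionals on the possible continuations of a diagram with a free upper boundary. -/
abbrev Half : Type := List (ℕ × KVPiece) → SkeinModule

/-- Putting a piece on top of a half diagram. -/
noncomputable def put (l : ℕ) (p : KVPiece) : Half →ₗ[QARing] Half where
  toFun f above := f ((l, p) :: above)
  map_add' _ _ := rfl
  map_smul' _ _ := rfl

/-- Putting a stack of pieces on top of a half diagram, the first of the list first. -/
noncomputable def putAll : List (ℕ × KVPiece) → Half →ₗ[QARing] Half
  | [] => LinearMap.id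
  | s :: w => putAll w ∘ₗ put s.1 s.2

theorem putAll_apply (w : List (ℕ × KVPiece)) (f : Half) (above) :
    putAll w f above = f (w ++ above) := by
  induction w generalizing f with
  | nil => rfl
  | cons s w ih => exact ih _

/-- A continuation records only the position of each piece from the left; the number of strands on
the right is recovered when the whole word is realized. Thus `put l p` is one linear operator,
regardless of the number of free ends. -/
noncomputable def half (w : List (ℕ × KVPiece)) : Half :=
  fun above => stackClass (realize 0 (w ++ above))

theorem putAll_half (w w' : List (ℕ × KVPiece)) : putAll w' (half w) = half (w ++ w') := by
  funext above
  rw [putAll_apply, half, half, List.append_assoc]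

theorem half_apply {n m : ℕ} {w w' above : List (ℕ × KVPiece)}
    (h : Composes src tgt 0 (realize 0 w) n) (h' : Composes src tgt n (realize n w') m) :
    putAll w' (half w) above = stackClass (realize 0 w ++ realize n w' ++ realize m above) := by
  rw [putAll_apply, half, realize_append h, realize_append h', List.append_assoc]

/-- The combinations of half diagrams with `n` free ends. -/
noncomputable def halves (n : ℕ) : Submodule QARing Half :=
  Submodule.span QARing {f | ∃ w, Composes src tgt 0 (realize 0 w) n ∧ f = half w}

/-- The relations make sense only when there are enough free ends, so they hold on `halves n` and
not on all functionals. By linearity they need only be checked on genuine half diagrams. -/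
theorem eqOn_halves {n : ℕ} {f g : Half →ₗ[QARing] Half}
    (h : ∀ w, Composes src tgt 0 (realize 0 w) n → f (half w) = g (half w)) {v : Half}
    (hv : v ∈ halves n) : f v = g v :=
  LinearMap.eqOn_span (s := {f | ∃ w, Composes src tgt 0 (realize 0 w) n ∧ f = half w})
    (by rintro _ ⟨w, hw, rfl⟩; exact h w hw) hv

theorem putAll_mem {n m : ℕ} {w : List (ℕ × KVPiece)} (h : Composes src tgt n (realize n w) m)
    {v : Half} (hv : v ∈ halves n) : putAll w v ∈ halves m := by
  refine Submodule.span_le (p := (halves m).comap (putAll w)).2 ?_ hv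
  rintro _ ⟨u, hu, rfl⟩
  refine Submodule.subset_span ⟨u ++ w, ?_, putAll_half _ _⟩
  rw [realize_append hu]
  exact hu.append h

theorem putAll_eq_of_localMove {n m : ℕ} {w w' : List (ℕ × KVPiece)}
    (hw : Composes src tgt n (realize n w) m) (hw' : Composes src tgt n (realize n w') m)
    (h : LocalMove (realize n w) (realize n w')) {v : Half} (hv : v ∈ halves n) :
    putAll w v = putAll w' v := by
  refine eqOn_halves (fun u hu => ?_) hv
  funext above
  rw [half_apply hu hw, half_apply hu hw', stackClass_isotopy hu hw hw' h]

theorem put_mem {n l : ℕ} (p : KVPiece) (h : l + p.bot ≤ n) {v : Half} (hv : v ∈ halves n) :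
    put l p v ∈ halves (n - p.bot + p.top) := by
  refine putAll_mem (w := [(l, p)]) ?_ hv
  simp only [realize, Composes, src, tgt]
  refine ⟨?_, ?_⟩ <;> omega

section HalfRelations

variable {n l : ℕ} {v : Half}

theorem put_exchange (hv : v ∈ halves n) (l k : ℕ) (x y : KVPiece) (h : l + x.bot + k + y.bot ≤ n) :
    put (l + x.top + k) y (put l x v) = put l x (put (l + x.bot + k) y v) := by
  obtain ⟨r, rfl⟩ := Nat.exists_eq_add_of_le h
  refine putAll_eq_of_localMove (w := [(l, x), (l + x.top + k, y)])
    (w' := [(l + x.bot + k, y), (l, x)]) (m := l + x.top + k + y.top + r) ?_ ?_ ?_ hv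
  · simp only [realize, Composes, src, tgt]; refine ⟨?_, ?_, ?_⟩ <;> omega
  · simp only [realize, Composes, src, tgt]; refine ⟨?_, ?_, ?_⟩ <;> omega
  · convert LocalMove.exchange l k r x y using 2 <;> simp only [realize] <;> congr <;> omega

end HalfRelations

end KnottedGraph

/-! ### The defining relations as identities between operators on half diagrams -/

namespace KnottedGraph

open KVPiece KVSlice

section HalfRelations

variable {n : ℕ} {v : Half}

theorem put_zigzag_left (hv : v ∈ halves n) (l : ℕ) (h : l + 1 ≤ n) :
    put (l + 1) cap (put l cup v) = v := by
  obtain ⟨r, rfl⟩ := Nat.exists_eq_add_of_le h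
  refine putAll_eq_of_localMove (w := [(l, cup), (l + 1, cap)])
    (w' := []) (m := l + 1 + r) ?_ ?_ ?_ hv
  · simp [realize, Composes, src, tgt, bot, top]; omega
  · simp [realize, Composes]
  · convert LocalMove.zigzag_left l r using 2 <;> simp [realize, bot, top]; omega

theorem put_zigzag_right (hv : v ∈ halves n) (l : ℕ) (h : l + 1 ≤ n) :
    put l cap (put (l + 1) cup v) = v := by
  obtain ⟨r, rfl⟩ := Nat.exists_eq_add_of_le h
  refine putAll_eq_of_localMove (w := [(l + 1, cup), (l, cap)])
    (w' := []) (m := l + 1 + r) ?_ ?_ ?_ hv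
  · simp [realize, Composes, src, tgt, bot, top]; omega
  · simp [realize, Composes]
  · convert LocalMove.zigzag_right l r using 2 <;> simp [realize, bot, top]; omega

theorem put_cup_slash (hv : v ∈ halves n) (l : ℕ) (h : l + 1 ≤ n) :
    put (l + 1) slash (put l cup v) = put l backslash (put (l + 1) cup v) := by
  obtain ⟨r, rfl⟩ := Nat.exists_eq_add_of_le h
  refine putAll_eq_of_localMove (w := [(l, cup), (l + 1, slash)])
    (w' := [(l + 1, cup), (l, backslash)]) (m := l + 3 + r) ?_ ?_ ?_ hv
  · simp [realize, Composes, src, tgt, bot, top]; omega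
  · simp [realize, Composes, src, tgt, bot, top]; omega
  · convert LocalMove.cup_slash l r using 2 <;> simp [realize, bot, top] <;> omega

theorem put_cup_backslash (hv : v ∈ halves n) (l : ℕ) (h : l + 1 ≤ n) :
    put (l + 1) backslash (put l cup v) = put l slash (put (l + 1) cup v) := by
  obtain ⟨r, rfl⟩ := Nat.exists_eq_add_of_le h
  refine putAll_eq_of_localMove (w := [(l, cup), (l + 1, backslash)])
    (w' := [(l + 1, cup), (l, slash)]) (m := l + 3 + r) ?_ ?_ ?_ hv
  · simp [realize, Composes, src, tgt, bot, top]; omega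
  · simp [realize, Composes, src, tgt, bot, top]; omega
  · convert LocalMove.cup_backslash l r using 2 <;> simp [realize, bot, top] <;> omega

theorem put_slash_cap (hv : v ∈ halves n) (l : ℕ) (h : l + 3 ≤ n) :
    put l cap (put (l + 1) slash v) = put (l + 1) cap (put l backslash v) := by
  obtain ⟨r, rfl⟩ := Nat.exists_eq_add_of_le h
  refine putAll_eq_of_localMove (w := [(l + 1, slash), (l, cap)])
    (w' := [(l, backslash), (l + 1, cap)]) (m := l + 1 + r) ?_ ?_ ?_ hv
  · simp [realize, Composes, src, tgt, bot, top]; omega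
  · simp [realize, Composes, src, tgt, bot, top]; omega
  · convert LocalMove.slash_cap l r using 2 <;> simp [realize, bot, top] <;> omega

theorem put_backslash_cap (hv : v ∈ halves n) (l : ℕ) (h : l + 3 ≤ n) :
    put l cap (put (l + 1) backslash v) = put (l + 1) cap (put l slash v) := by
  obtain ⟨r, rfl⟩ := Nat.exists_eq_add_of_le h
  refine putAll_eq_of_localMove (w := [(l + 1, backslash), (l, cap)])
    (w' := [(l, slash), (l + 1, cap)]) (m := l + 1 + r) ?_ ?_ ?_ hv
  · simp [realize, Composes, src, tgt, bot, top]; omega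
  · simp [realize, Composes, src, tgt, bot, top]; omega
  · convert LocalMove.backslash_cap l r using 2 <;> simp [realize, bot, top] <;> omega

theorem put_reidemeister_two (hv : v ∈ halves n) (l : ℕ) (h : l + 2 ≤ n) :
    put l backslash (put l slash v) = v := by
  obtain ⟨r, rfl⟩ := Nat.exists_eq_add_of_le h
  refine putAll_eq_of_localMove (w := [(l, slash), (l, backslash)])
    (w' := []) (m := l + 2 + r) ?_ ?_ ?_ hv
  · simp [realize, Composes, src, tgt, bot, top]
  · simp [realize, Composes]
  · convert LocalMove.reidemeister_two l r using 2 <;> simp [realize, bot, top]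

theorem put_reidemeister_two' (hv : v ∈ halves n) (l : ℕ) (h : l + 2 ≤ n) :
    put l slash (put l backslash v) = v := by
  obtain ⟨r, rfl⟩ := Nat.exists_eq_add_of_le h
  refine putAll_eq_of_localMove (w := [(l, backslash), (l, slash)])
    (w' := []) (m := l + 2 + r) ?_ ?_ ?_ hv
  · simp [realize, Composes, src, tgt, bot, top]
  · simp [realize, Composes]
  · convert LocalMove.reidemeister_two' l r using 2 <;> simp [realize, bot, top]

theorem put_reidemeister_three (hv : v ∈ halves n) (l : ℕ) (h : l + 3 ≤ n) :
    put l slash (put (l + 1) slash (put l slash v)) =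
      put (l + 1) slash (put l slash (put (l + 1) slash v)) := by
  obtain ⟨r, rfl⟩ := Nat.exists_eq_add_of_le h
  refine putAll_eq_of_localMove (w := [(l, slash), (l + 1, slash), (l, slash)])
    (w' := [(l + 1, slash), (l, slash), (l + 1, slash)]) (m := l + 3 + r) ?_ ?_ ?_ hv
  · simp [realize, Composes, src, tgt, bot, top]; omega
  · simp [realize, Composes, src, tgt, bot, top]; omega
  · convert LocalMove.reidemeister_three l r using 2 <;> simp [realize, bot, top] <;> omega

theorem half_eq {w above : List (ℕ × KVPiece)} (h : Composes src tgt 0 (realize 0 w) n) :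
    half w above = stackClass (realize 0 w ++ [] ++ realize n above) := by
  rw [half, realize_append h, List.append_nil]

theorem put_circle (hv : v ∈ halves n) (l : ℕ) (h : l ≤ n) :
    put l cap (put l cup v) = loopValue • v := by
  obtain ⟨r, rfl⟩ := Nat.exists_eq_add_of_le h
  refine eqOn_halves (f := putAll [(l, cup), (l, cap)])
    (g := loopValue • LinearMap.id) (fun u hu => ?_) hv
  funext above
  rw [half_apply (m := l + r) hu (by simp [realize, Composes, src, tgt, bot, top])]
  have h1 : realize (l + r) [(l, cup), (l, cap)] = [⟨l, cup, r⟩, ⟨l, cap, r⟩] := by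
    simp [realize, bot, top]
  rw [h1, stackClass_circle hu, ← half_eq hu]
  rfl

theorem put_kink (hv : v ∈ halves n) (l : ℕ) (h : l + 1 ≤ n) :
    put (l + 1) cap (put l slash (put (l + 1) cup v)) = a • v := by
  obtain ⟨r, rfl⟩ := Nat.exists_eq_add_of_le h
  refine eqOn_halves (f := putAll [(l + 1, cup), (l, slash), (l + 1, cap)])
    (g := a • LinearMap.id) (fun u hu => ?_) hv
  funext above
  have h1 : realize (l + 1 + r) [(l + 1, cup), (l, slash), (l + 1, cap)] =
      [⟨l + 1, cup, r⟩, ⟨l, slash, r + 1⟩, ⟨l + 1, cap, r⟩] := by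
    simp [realize, bot, top]
    omega
  rw [half_apply (m := l + 1 + r) hu (by rw [h1]; simp [Composes, src, tgt, bot, top]; omega), h1,
    stackClass_kink hu, ← half_eq hu]
  rfl

theorem realize_piece (l r : ℕ) {p : KVPiece} (hp : p.bot = 2) :
    realize (l + 2 + r) [(l, p)] = [⟨l, p, r⟩] := by
  simp [realize, hp]

theorem realize_capCup (l r : ℕ) :
    realize (l + 2 + r) [(l, cap), (l, cup)] = [⟨l, cap, r⟩, ⟨l, cup, r⟩] := by
  simp [realize, bot, top]

theorem put_crossing (hv : v ∈ halves n) (l : ℕ) (h : l + 2 ≤ n) :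
    put l slash v = put l backslash v + (q - qInv) • (v - put l cup (put l cap v)) := by
  obtain ⟨r, rfl⟩ := Nat.exists_eq_add_of_le h
  refine eqOn_halves (f := putAll [(l, slash)]) (g := putAll [(l, backslash)] +
    (q - qInv) • (LinearMap.id - putAll [(l, cap), (l, cup)])) (fun u hu => ?_) hv
  funext above
  simp only [LinearMap.add_apply, LinearMap.smul_apply, LinearMap.sub_apply,
    LinearMap.id_apply, Pi.add_apply,
    Pi.smul_apply, Pi.sub_apply]
  rw [half_apply (m := l + 2 + r) hu
      (by rw [realize_piece l r rfl]; exact composes_piece l r rfl rfl),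
    half_apply (m := l + 2 + r) hu
      (by rw [realize_piece l r rfl]; exact composes_piece l r rfl rfl),
    half_apply (m := l + 2 + r) hu (by rw [realize_capCup]; exact composes_capCup l r),
    half_eq hu, realize_capCup,
    realize_piece l r rfl, realize_piece l r rfl]
  exact stackClass_crossing hu

theorem put_vertex (hv : v ∈ halves n) (l : ℕ) (h : l + 2 ≤ n) :
    put l vertex v = -put l slash v + q • v + qInv • put l cup (put l cap v) := by
  obtain ⟨r, rfl⟩ := Nat.exists_eq_add_of_le h
  refine eqOn_halves (f := putAll [(l, vertex)]) (g := -putAll [(l, slash)] +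
    q • LinearMap.id + qInv • putAll [(l, cap), (l, cup)]) (fun u hu => ?_) hv
  funext above
  simp only [LinearMap.add_apply, LinearMap.smul_apply, LinearMap.neg_apply,
    LinearMap.id_apply, Pi.add_apply,
    Pi.smul_apply, Pi.neg_apply]
  rw [half_apply (m := l + 2 + r) hu
      (by rw [realize_piece l r rfl]; exact composes_piece l r rfl rfl),
    half_apply (m := l + 2 + r) hu
      (by rw [realize_piece l r rfl]; exact composes_piece l r rfl rfl),
    half_apply (m := l + 2 + r) hu (by rw [realize_capCup]; exact composes_capCup l r),
    half_eq hu, realize_capCup,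
    realize_piece l r rfl, realize_piece l r rfl]
  exact stackClass_vertex hu

/-! ### Twisted minima and maxima -/

theorem aInv_smul_a_smul (u : Half) : aInv • a • u = u := by
  rw [smul_smul, aInv, a, ← LaurentPolynomial.T_add]
  simp

theorem put_cup_mem (hv : v ∈ halves n) {l : ℕ} (h : l ≤ n) : put l cup v ∈ halves (n + 2) :=
  put_mem cup h hv

theorem put_slash_mem (hv : v ∈ halves n) {l : ℕ} (h : l + 2 ≤ n) : put l slash v ∈ halves n := by
  have := put_mem slash h hv
  rwa [show n - slash.bot + slash.top = n from Nat.sub_add_cancel (show 2 ≤ n by omega)] at this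

theorem put_backslash_mem (hv : v ∈ halves n) {l : ℕ} (h : l + 2 ≤ n) :
    put l backslash v ∈ halves n := by
  have := put_mem backslash h hv
  rwa [show n - backslash.bot + backslash.top = n from
    Nat.sub_add_cancel (show 2 ≤ n by omega)] at this

/-- The kink on the right of a strand, turned. -/
theorem put_kink_cup (hv : v ∈ halves n) (l : ℕ) (h : l + 1 ≤ n) :
    put l cap (put (l + 1) backslash (put (l + 1) cup v)) = a • v := by
  rw [put_backslash_cap (put_cup_mem hv h) l (by omega), put_kink hv l h]

theorem put_kink_cap (hv : v ∈ halves n) (l : ℕ) (h : l + 1 ≤ n) :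
    put (l + 1) cap (put (l + 1) backslash (put l cup v)) = a • v := by
  rw [put_cup_backslash hv l h, put_kink hv l h]

/-- The factor a is traded for a kink on the right leg of the minimum. The minimum of the kink can
be created on the far left instead, at the cost of moving the crossing onto the original minimum;
what remains of the kink is a zigzag, which straightens. -/
theorem put_backslash_cup (hv : v ∈ halves n) (l : ℕ) (h : l ≤ n) :
    put l backslash (put l cup v) = a • put l cup v := by
  have h1 := put_cup_mem hv h
  have h2 := put_exchange hv l 0 cup cup h
  have h3 := put_exchange h1 l 0 cup backslash (by simp only [bot]; omega)
  simp only [bot, top, add_zero] at h2 h3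
  rw [← put_kink_cup h1 (l + 1) (by omega), show l + 1 + 1 = l + 2 from rfl, h2, h3,
    put_zigzag_left (put_backslash_mem h1 (by omega)) l (by omega)]

/-- The same argument upside down: a kink is created on the right leg of the maximum, and exchanging
the two maxima leaves a zigzag. -/
theorem put_cap_backslash (hv : v ∈ halves n) (l : ℕ) (h : l + 2 ≤ n) :
    put l cap (put l backslash v) = a • put l cap v := by
  have h1 := put_cup_mem hv (l := l + 1) (by omega)
  have h2 := put_exchange (put_backslash_mem h1 (l := l + 2) (by omega)) l 0 cap cap
    (by simp only [bot]; omega)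
  have h3 := put_exchange h1 l 0 cap backslash (by simp only [bot]; omega)
  simp only [bot, top, add_zero] at h2 h3
  rw [← map_smul, ← put_kink_cap hv (l + 1) (by omega), show l + 1 + 1 = l + 2 from rfl, ← h2, ← h3,
    put_zigzag_right hv l (by omega)]

theorem put_slash_cup (hv : v ∈ halves n) (l : ℕ) (h : l ≤ n) :
    put l slash (put l cup v) = aInv • put l cup v := by
  have h1 := put_reidemeister_two' (put_cup_mem hv h) l (by omega)
  rw [put_backslash_cup hv l h, map_smul] at h1
  nth_rewrite 2 [← h1]
  rw [aInv_smul_a_smul]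

theorem put_cap_slash (hv : v ∈ halves n) (l : ℕ) (h : l + 2 ≤ n) :
    put l cap (put l slash v) = aInv • put l cap v := by
  have h1 := put_cap_backslash (put_slash_mem hv h) l h
  rw [put_reidemeister_two hv l h] at h1
  rw [h1, aInv_smul_a_smul]

/-! ### Minima with a long right leg -/

/-- A minimum whose left leg is the leftmost strand and whose right leg passes over `j` strands. -/
noncomputable def longCup : ℕ → Half →ₗ[QARing] Half
  | 0 => put 0 cup
  | j + 1 => put (j + 1) slash ∘ₗ longCup j

theorem longCup_succ (j : ℕ) (v : Half) : longCup (j + 1) v = put (j + 1) slash (longCup j v) := rfl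

theorem longCup_mem (hv : v ∈ halves n) {j : ℕ} (h : j ≤ n) : longCup j v ∈ halves (n + 2) := by
  induction j with
  | zero => exact put_cup_mem hv h
  | succ j ih => exact put_slash_mem (ih (by omega)) (by omega)

/-- A piece to the right of a long minimum. -/
theorem put_longCup_right (hv : v ∈ halves n) (p : KVPiece) {j k : ℕ} (hjk : j ≤ k)
    (h : k + p.bot ≤ n) : put (k + 2) p (longCup j v) = longCup j (put k p v) := by
  induction j with
  | zero =>
    have := put_exchange hv 0 k cup p (by have : cup.bot = 0 := rfl; omega)
    simp only [bot, top, zero_add] at this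
    rw [add_comm k 2]
    exact this
  | succ j ih =>
    obtain ⟨m, rfl⟩ := Nat.exists_eq_add_of_le hjk
    have := put_exchange (longCup_mem hv (j := j) (by omega)) (j + 1) m slash p
      (by have : slash.bot = 2 := rfl; omega)
    simp only [bot, top] at this
    rw [longCup_succ, longCup_succ, ← ih (by omega), show j + 1 + m + 2 = j + 1 + 2 + m by omega,
      this]

/-- A crossing below the long leg slides under it by Reidemeister move III. The shift of the
position by one comes from the left leg of the minimum, which stands at the far left. -/
theorem put_slash_longCup (hv : v ∈ halves n) {j k : ℕ} (hkj : k + 2 ≤ j) (h : j ≤ n) :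
    put (k + 1) slash (longCup j v) = longCup j (put k slash v) := by
  induction j, hkj using Nat.le_induction with
  | base =>
    rw [longCup_succ, longCup_succ,
      put_reidemeister_three (longCup_mem hv (by omega)) (k + 1) (by omega),
      put_longCup_right hv slash le_rfl h]
    rfl
  | succ j hkj ih =>
    obtain ⟨m, rfl⟩ := Nat.exists_eq_add_of_le hkj
    have := put_exchange (longCup_mem hv (j := k + 2 + m) (by omega)) (k + 1) m slash slash
      (by simp only [bot]; omega)
    simp only [bot, top] at this
    rw [longCup_succ, longCup_succ, ← ih (by omega),
      show k + 2 + m + 1 = k + 1 + 2 + m by omega, this]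

/-- A minimum created to the left of the long leg's end may be created first, with the leg then
passing over its two strands. In the base case one of these crossings turns through the minimum and
cancels the other. -/
theorem put_cup_longCup (hv : v ∈ halves n) {k m : ℕ} (hkm : k ≤ m) (h : m ≤ n) :
    put (k + 1) cup (longCup m v) = longCup (m + 2) (put k cup v) := by
  induction m, hkm using Nat.le_induction with
  | base =>
    have h1 := longCup_mem hv h
    rw [longCup_succ, longCup_succ, ← put_longCup_right hv cup le_rfl h,
      ← put_cup_backslash h1 (k + 1) (by omega),
      put_reidemeister_two' (put_cup_mem h1 (by omega)) (k + 1 + 1) (by omega)]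
  | succ m hkm ih =>
    obtain ⟨i, rfl⟩ := Nat.exists_eq_add_of_le hkm
    have := put_exchange (longCup_mem hv (j := k + i) (by omega)) (k + 1) i cup slash
      (by simp only [bot]; omega)
    simp only [bot, top, add_zero] at this
    rw [longCup_succ (k + i), longCup_succ (k + i + 2), ← ih (by omega),
      show k + i + 1 = k + 1 + i by omega, show k + i + 2 + 1 = k + 1 + 2 + i by omega, this]

/-- A maximum slides under the long leg: one of the two crossings of the leg turns through the
maximum and cancels the other, so the leg passes over two strands fewer. -/
theorem put_cap_longCup (hv : v ∈ halves n) {k i : ℕ} (hki : k ≤ i) (h : i + 2 ≤ n) :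
    put (k + 1) cap (longCup (i + 2) v) = longCup i (put k cap v) := by
  induction i, hki using Nat.le_induction with
  | base =>
    have h1 := longCup_mem hv (j := k) (by omega)
    rw [longCup_succ, longCup_succ,
      put_slash_cap (put_slash_mem h1 (by omega)) (k + 1) (by omega),
      put_reidemeister_two h1 _ (by omega), put_longCup_right hv cap le_rfl h]
  | succ i hki ih =>
    obtain ⟨m, rfl⟩ := Nat.exists_eq_add_of_le hki
    have := put_exchange (longCup_mem hv (j := k + m + 2) (by omega)) (k + 1) m cap slash
      (by simp only [bot]; omega)
    simp only [bot, top, add_zero] at this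
    rw [longCup_succ (k + m), ← ih (by omega), show k + m + 1 + 2 = k + m + 2 + 1 by omega,
      longCup_succ (k + m + 2), show k + m + 1 = k + 1 + m by omega,
      show k + m + 2 + 1 = k + 1 + 2 + m by omega, this]

end HalfRelations

/-! ### The spanning set -/

/-- The half diagrams with `n` free ends that consist of long minima. -/
noncomputable def standard : ℕ → Submodule QARing Half
  | 0 => Submodule.span QARing {half []}
  | 1 => ⊥
  | n + 2 => ⨆ j : Fin (n + 1), (standard n).map (longCup j)

theorem standard_le_halves (n : ℕ) : standard n ≤ halves n := by
  induction n using Nat.twoStepInduction with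
  | zero => exact Submodule.span_mono fun f hf => ⟨[], rfl, hf⟩
  | one => exact bot_le
  | more n ih _ =>
    refine iSup_le fun j => ?_
    rintro _ ⟨v, hv, rfl⟩
    exact longCup_mem (ih hv) (by omega)

theorem longCup_mem_standard {n j : ℕ} (h : j ≤ n) {v : Half} (hv : v ∈ standard n) :
    longCup j v ∈ standard (n + 2) :=
  le_iSup (fun j : Fin (n + 1) => (standard n).map (longCup j)) ⟨j, by omega⟩ ⟨v, hv, rfl⟩

/-- A linear map sends `standard (n + 2)` to a submodule if it does so with all long minima. -/
theorem map_mem_of_longCup {n : ℕ} {f : Half →ₗ[QARing] Half} {M : Submodule QARing Half}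
    (h : ∀ j ≤ n, ∀ v ∈ standard n, f (longCup j v) ∈ M) {v : Half} (hv : v ∈ standard (n + 2)) :
    f v ∈ M := by
  refine (iSup_le fun j => ?_ : standard (n + 2) ≤ M.comap f) hv
  rintro _ ⟨v, hv, rfl⟩
  exact h j (by omega) v hv

/-- At the far left the new minimum is itself a long one of length 0. Elsewhere it slides below the
outermost long minimum, under its leg or beside it, and induction applies to the matching
underneath. -/
theorem put_cup_mem_standard (n : ℕ) :
    ∀ i ≤ n, ∀ v ∈ standard n, put i cup v ∈ standard (n + 2) := by
  induction n using Nat.twoStepInduction with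
  | zero =>
    intro i hi v hv
    obtain rfl : i = 0 := by omega
    exact longCup_mem_standard (j := 0) le_rfl hv
  | one =>
    intro i hi v hv
    rw [(Submodule.mem_bot QARing).1 hv, map_zero]
    exact zero_mem _
  | more n ih _ =>
    intro i hi v hv
    rcases i with _ | i
    · exact longCup_mem_standard (j := 0) (by omega) hv
    refine map_mem_of_longCup (fun m hm u hu => ?_) hv
    by_cases him : i ≤ m
    · rw [put_cup_longCup (standard_le_halves n hu) him hm]
      exact longCup_mem_standard (by omega) (ih i (by omega) u hu)
    · obtain ⟨k, rfl⟩ := Nat.exists_eq_add_of_le (show 1 ≤ i by omega)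
      rw [show 1 + k + 1 = k + 2 by omega,
        put_longCup_right (standard_le_halves n hu) cup (by omega) (by simp only [bot]; omega)]
      exact longCup_mem_standard (by omega) (ih k (by omega) u hu)

/-- The standard half diagrams with `n` free ends are closed under crossings and maxima. -/
def StandardClosed (n : ℕ) : Prop :=
  ∀ i, i + 2 ≤ n → ∀ v ∈ standard n, put i slash v ∈ standard n ∧ put i cap v ∈ standard (n - 2)

theorem StandardClosed.cup_cap {n : ℕ} (h : StandardClosed n) {i : ℕ} (hi : i + 2 ≤ n) {v : Half}
    (hv : v ∈ standard n) : put i cup (put i cap v) ∈ standard n := by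
  obtain ⟨m, rfl⟩ := Nat.exists_eq_add_of_le' (show 2 ≤ n by omega)
  exact put_cup_mem_standard m i (by omega) _ (h i hi v hv).2

/-- The crossing relation expresses this crossing by the other one and by pieces already treated;
the vertex is handled in the same way. Hence only `slash` and `cap` appear in the definition. -/
theorem StandardClosed.backslash {n : ℕ} (h : StandardClosed n) {i : ℕ} (hi : i + 2 ≤ n) {v : Half}
    (hv : v ∈ standard n) : put i backslash v ∈ standard n := by
  have h1 := put_crossing (standard_le_halves n hv) i hi
  rw [← sub_eq_iff_eq_add] at h1
  rw [← h1]
  exact sub_mem (h i hi v hv).1 (Submodule.smul_mem _ _ (sub_mem hv (h.cup_cap hi hv)))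

theorem StandardClosed.vertex {n : ℕ} (h : StandardClosed n) {i : ℕ} (hi : i + 2 ≤ n) {v : Half}
    (hv : v ∈ standard n) : put i vertex v ∈ standard n := by
  rw [put_vertex (standard_le_halves n hv) i hi]
  exact add_mem (add_mem (neg_mem (h i hi v hv).1) (Submodule.smul_mem _ _ hv))
    (Submodule.smul_mem _ _ (h.cup_cap hi hv))

/-- The maximum joins the end of the long leg to its right neighbour, so the minimum straightens to
a strand crossing `j` others. Each step turns the last crossing through the maximum and pushes it
below the long minimum, where closure on `n` strands absorbs it. -/
theorem StandardClosed.cap_longCup_self {n : ℕ} (h : StandardClosed n) {j : ℕ} (hj : j + 1 ≤ n)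
    {v : Half} (hv : v ∈ standard n) : put (j + 1) cap (longCup j v) ∈ standard n := by
  induction j generalizing v with
  | zero =>
    rw [longCup, put_zigzag_left (standard_le_halves n hv) 0 hj]
    exact hv
  | succ j ih =>
    have h1 := longCup_mem (standard_le_halves n hv) (j := j) (by omega)
    rw [longCup_succ, ← put_backslash_cap h1 (j + 1) (by omega),
      put_longCup_right (standard_le_halves n hv) KVPiece.backslash le_rfl hj]
    exact ih (by omega) (h.backslash hj hv)

/-- The cases are the positions of the maximum relative to the legs. On the left leg it closes a
circle, undoes a twist with factor a, or commutes with the last crossing of the leg. On the right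
leg it straightens the minimum, after undoing a twist if it lies on the leg's last crossing.
Anywhere else it slides below the long minimum. -/
theorem StandardClosed.cap_longCup {n : ℕ} (h : StandardClosed n) {i j : ℕ} (hi : i ≤ n)
    (hj : j ≤ n) {v : Half} (hv : v ∈ standard n) : put i cap (longCup j v) ∈ standard n := by
  have hv' := standard_le_halves n hv
  rcases i with _ | i
  · induction j using Nat.twoStepInduction with
    | zero =>
      rw [longCup, put_circle hv' 0 hi]
      exact Submodule.smul_mem _ _ hv
    | one =>
      rw [longCup_succ, longCup, put_cup_slash hv' 0 hj,
        put_cap_backslash (put_cup_mem hv' hj) 0 (by omega), put_zigzag_right hv' 0 hj]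
      exact Submodule.smul_mem _ _ hv
    | more j _ ih =>
      have h1 := put_exchange (longCup_mem hv' (j := j + 1) (by omega)) 0 j cap slash
        (by simp only [bot]; omega)
      simp only [bot, top, zero_add] at h1
      rw [longCup_succ, show j + 1 + 1 = 2 + j by omega, ← h1]
      exact (h j hj _ (ih (by omega))).1
  · rcases lt_trichotomy i j with hij | rfl | hij
    · obtain ⟨j, rfl⟩ := Nat.exists_eq_add_of_le' (show 1 ≤ j by omega)
      rcases (show i = j ∨ i + 1 ≤ j by omega) with rfl | hij'
      · rw [longCup_succ, put_cap_slash (longCup_mem hv' (by omega)) _ (by omega)]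
        exact Submodule.smul_mem _ _ (h.cap_longCup_self (by omega) hv)
      · obtain ⟨j, rfl⟩ := Nat.exists_eq_add_of_le' (show 1 ≤ j by omega)
        obtain ⟨m, rfl⟩ := Nat.exists_eq_add_of_le' (show 2 ≤ n by omega)
        rw [put_cap_longCup hv' (show i ≤ j by omega) (by omega)]
        exact longCup_mem_standard (by omega) (h i (by omega) v hv).2
    · exact h.cap_longCup_self hi hv
    · obtain ⟨k, rfl⟩ := Nat.exists_eq_add_of_le' (show 1 ≤ i by omega)
      obtain ⟨m, rfl⟩ := Nat.exists_eq_add_of_le' (show 2 ≤ n by omega)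
      rw [put_longCup_right hv' cap (by omega) (by simp only [bot]; omega)]
      exact longCup_mem_standard (by omega) (h k (by omega) v hv).2

/-- A crossing just right of the leg's end lengthens the leg. One lying on the leg's last crossing
is first switched by the crossing relation, so that the two cancel; the other terms are standard by
closure under maxima and minima. Any other crossing slides below the long minimum. -/
theorem StandardClosed.slash_longCup {n : ℕ} (h : StandardClosed n) {i j : ℕ} (hi : i + 1 ≤ n)
    (hj : j ≤ n) {v : Half} (hv : v ∈ standard n) :
    put (i + 1) slash (longCup j v) ∈ standard (n + 2) := by
  have hv' := standard_le_halves n hv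
  rcases lt_trichotomy i j with hij | rfl | hij
  · obtain ⟨j, rfl⟩ := Nat.exists_eq_add_of_le' (show 1 ≤ j by omega)
    rcases (show i = j ∨ i + 1 ≤ j by omega) with rfl | hij'
    · have h1 := longCup_mem hv' (j := i) (by omega)
      rw [put_crossing (longCup_mem hv' hj) _ (by omega)]
      refine add_mem ?_ (Submodule.smul_mem _ _ (sub_mem (longCup_mem_standard hj hv) ?_))
      · rw [longCup_succ, put_reidemeister_two h1 _ (by omega)]
        exact longCup_mem_standard (by omega) hv
      · exact put_cup_mem_standard n _ hi _ (h.cap_longCup hi hj hv)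
    · rw [put_slash_longCup hv' (by omega) hj]
      exact longCup_mem_standard hj (h i (by omega) v hv).1
  · exact longCup_mem_standard hi hv
  · obtain ⟨k, rfl⟩ := Nat.exists_eq_add_of_le' (show 1 ≤ i by omega)
    rw [put_longCup_right hv' slash (by omega) (by simp only [bot]; omega)]
    exact longCup_mem_standard hj (h k (by omega) v hv).1

/-- A strand passing over the left leg of a long minimum. -/
theorem StandardClosed.slash_zero_longCup {n : ℕ} (h : StandardClosed n) {j : ℕ} (hj : j ≤ n)
    {v : Half} (hv : v ∈ standard n) : put 0 slash (longCup j v) ∈ standard (n + 2) := by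
  have hv' := standard_le_halves n hv
  induction j using Nat.twoStepInduction with
  | zero =>
    rw [longCup, put_slash_cup hv' 0 hj]
    exact Submodule.smul_mem _ _ (longCup_mem_standard hj hv)
  | one =>
    rw [longCup_succ, longCup, put_cup_slash hv' 0 hj,
      put_reidemeister_two' (put_cup_mem hv' hj) 0 (by omega)]
    exact put_cup_mem_standard n 1 hj v hv
  | more j _ ih =>
    have h1 := put_exchange (longCup_mem hv' (j := j + 1) (by omega)) 0 j slash slash
      (by simp only [bot]; omega)
    simp only [bot, top, zero_add] at h1
    rw [longCup_succ, show j + 1 + 1 = 2 + j by omega, ← h1, show 2 + j = j + 1 + 1 by omega]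
    -- The last crossing of the leg is now on top and is not at the far left, so the previous lemma
    -- applies to it on each long minimum.
    exact map_mem_of_longCup (fun m hm u hu => h.slash_longCup (by omega) hm hu) (ih (by omega))

/-- Removing the outermost long minimum lowers the number of free ends by two, whence the induction
in steps of two. -/
theorem standardClosed (n : ℕ) : StandardClosed n := by
  induction n using Nat.twoStepInduction with
  | zero => intro i hi; omega
  | one => intro i hi; omega
  | more n h _ =>
    intro i hi v hv
    refine ⟨?_, map_mem_of_longCup (fun j hj u hu => h.cap_longCup (by omega) hj hu) hv⟩
    rcases i with _ | i
    · exact map_mem_of_longCup (fun j hj u hu => h.slash_zero_longCup hj hu) hv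
    · exact map_mem_of_longCup (fun j hj u hu => h.slash_longCup (by omega) hj hu) hv

theorem putAll_mem_standard {n m : ℕ} {w : List (ℕ × KVPiece)}
    (hw : Composes src tgt n (realize n w) m) {v : Half} (hv : v ∈ standard n) :
    putAll w v ∈ standard m := by
  induction w generalizing n v with
  | nil => rwa [← show n = m from hw]
  | cons s w ih =>
    obtain ⟨l, p⟩ := s
    obtain ⟨h1, h2⟩ := hw
    refine ih h2 ?_
    simp only [src] at h1
    have h3 : l + p.bot ≤ n := by omega
    have h4 : l + p.top + (n - (l + p.bot)) = n - p.bot + p.top := by omega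
    simp only [tgt, h4]
    cases p with
    | cup => exact put_cup_mem_standard n l h3 v hv
    | cap => exact (standardClosed n l h3 v hv).2
    | slash =>
      rw [show n - slash.bot + slash.top = n from
        Nat.sub_add_cancel (by simp only [bot] at *; omega)]
      exact (standardClosed n l h3 v hv).1
    | backslash =>
      rw [show n - backslash.bot + backslash.top = n from
        Nat.sub_add_cancel (by simp only [bot] at *; omega)]
      exact (standardClosed n).backslash h3 hv
    | vertex =>
      rw [show n - vertex.bot + vertex.top = n from
        Nat.sub_add_cancel (by simp only [bot] at *; omega)]
      exact (standardClosed n).vertex h3 hv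

/-- The defining relations reduce every diagram to a multiple of the empty diagram. -/
theorem exists_isKauffmanVogel (D : KnottedGraph) : ∃ p, D.IsKauffmanVogel p := by
  obtain ⟨u, hu⟩ := exists_realize D.closed
  have hc : Composes src tgt 0 (realize 0 u) 0 := by rw [hu]; exact D.closed
  have h1 : putAll u (half []) ∈ standard 0 :=
    putAll_mem_standard hc (Submodule.mem_span_singleton_self _)
  obtain ⟨p, hp⟩ := Submodule.mem_span_singleton.1 h1
  refine ⟨p, ?_⟩
  -- The empty continuation turns the identity of functionals into one between the classes of `D`
  -- and of the empty diagram.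
  have h2 := congrFun hp []
  rw [putAll_apply, Pi.smul_apply, half, half, List.append_nil, List.nil_append, List.append_nil,
    hu, stackClass_of_composes D.closed, realize, stackClass_of_composes (composes_nil 0),
    ← Submodule.Quotient.mk_smul] at h2
  exact (Submodule.Quotient.eq _).1 h2.symm

end KnottedGraph

/-! ## Transfer matrices for the MOY state sum -/

/-- A row of labelled strands with colors `l`, labelled by subsets of `{2k - N + 1}`. -/
def IsLabelled (N : ℕ) (L : List (Dir × Finset ℤ)) (l : List (Dir × ℕ)) : Prop :=
  L.map (Prod.map id Finset.card) = l ∧ ∀ x ∈ L, x.2 ⊆ moyIndex N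

theorem IsLabelled.append {N : ℕ} {L L' : List (Dir × Finset ℤ)} {l l' : List (Dir × ℕ)}
    (h : IsLabelled N L l) (h' : IsLabelled N L' l') : IsLabelled N (L ++ L') (l ++ l') :=
  ⟨by rw [List.map_append, h.1, h'.1], fun x hx => (List.mem_append.1 hx).elim (h.2 x) (h'.2 x)⟩

theorem isLabelled_singleton {N : ℕ} {A : Finset ℤ} (hA : A ⊆ moyIndex N) {n : ℕ}
    (hn : A.card = n) (d : Dir) : IsLabelled N [(d, A)] [(d, n)] :=
  ⟨by simp [hn], by simpa using hA⟩

namespace MOYPiece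

/-- Twice the exponent of `q` that a piece contributes to a state. -/
def exponent (N : ℕ) (p : MOYPiece (Finset ℤ)) : ℤ :=
  p.twiceWeight + ∑ i ∈ moyIndex N, i * p.turn i

/-- The labellings of the colored piece `p` whose lower boundary is `M`. -/
def labellings (N : ℕ) (p : MOYPiece ℕ) (M : List (Dir × Finset ℤ)) : Set (MOYPiece (Finset ℤ)) :=
  {π | π.map Finset.card = p ∧ π.bot (· ∪ ·) = M ∧ (∀ A ∈ π.labels, A ⊆ moyIndex N) ∧
    π.SumDisjoint}

end MOYPiece

namespace MOYSlice

/-- The labellings of the colored slice `t` whose lower boundary is `ρ`. -/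
def labellings (N : ℕ) (t : MOYSlice ℕ) (ρ : List (Dir × Finset ℤ)) : Set (MOYSlice (Finset ℤ)) :=
  {s | s.map Finset.card = t ∧ s.src (· ∪ ·) = ρ ∧ (∀ A ∈ s.labels, A ⊆ moyIndex N) ∧
    s.piece.SumDisjoint}

theorem finite_labellings (N : ℕ) (t : MOYSlice ℕ) (ρ) : (labellings N t ρ).Finite :=
  (finite_moySlices (moyIndex N) t).subset fun _ h => ⟨h.1, h.2.2.1⟩

theorem _root_.MOYPiece.finite_labellings (N : ℕ) (p : MOYPiece ℕ) (M) :
    (p.labellings N M).Finite := by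
  refine ((finite_moySlices (moyIndex N) ⟨[], p, []⟩).preimage
    (f := fun π => (⟨[], π, []⟩ : MOYSlice (Finset ℤ))) ?_).subset ?_
  · intro π _ π' _ h
    simpa using h
  · rintro π ⟨h1, -, h2, -⟩
    exact ⟨by simp [map, h1], by simpa [labels] using h2⟩

/-- The action of a colored slice on functions of labelled rows. -/
noncomputable def transfer (N : ℕ) (t : MOYSlice ℕ) (g : List (Dir × Finset ℤ) → QField)
    (ρ : List (Dir × Finset ℤ)) : QField :=
  ∑ s ∈ (finite_labellings N t ρ).toFinset,
    qHalf ^ s.piece.exponent N * g (s.tgt (· ∪ ·))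

noncomputable def transferAll (N : ℕ) : List (MOYSlice ℕ) → (List (Dir × Finset ℤ) → QField) →
    List (Dir × Finset ℤ) → QField
  | [], g => g
  | t :: w, g => transfer N t (transferAll N w g)

theorem transferAll_append (N : ℕ) (w w' : List (MOYSlice ℕ)) (g) :
    transferAll N (w ++ w') g = transferAll N w (transferAll N w' g) := by
  induction w with
  | nil => rfl
  | cons t w ih => rw [List.cons_append, transferAll, transferAll, ih]

/-- The idle strands leave no choice: the colours fix the number of strands on each side of the
piece, so the lower row determines their labels. -/
theorem transfer_eq_sum_labellings {N : ℕ} {L R : List (Dir × Finset ℤ)} {l r : List (Dir × ℕ)}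
    (hL : IsLabelled N L l) (hR : IsLabelled N R r) (p : MOYPiece ℕ) (g) (M) :
    transfer N ⟨l, p, r⟩ g (L ++ M ++ R) = ∑ π ∈ (p.finite_labellings N M).toFinset,
      qHalf ^ π.exponent N * g (L ++ π.top (· ∪ ·) ++ R) := by
  symm
  refine Finset.sum_bij (fun π _ => ⟨L, π, R⟩) ?_ ?_ ?_ ?_
  · intro π hπ
    rw [Set.Finite.mem_toFinset] at hπ ⊢
    obtain ⟨h1, h2, h3, h4⟩ := hπ
    refine ⟨by simp [map, h1, hL.1, hR.1], by simp [src, h2], fun A hA => ?_, h4⟩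
    simp only [labels, List.mem_append, List.mem_map] at hA
    rcases hA with (⟨x, hx, rfl⟩ | hA) | ⟨x, hx, rfl⟩
    exacts [hL.2 x hx, h3 A hA, hR.2 x hx]
  · intro π _ π' _ h
    simpa using h
  · rintro ⟨L', π, R'⟩ hs
    rw [Set.Finite.mem_toFinset] at hs
    obtain ⟨h1, h2, h3, h4⟩ := hs
    simp only [map, Slice.mk.injEq] at h1
    have hl : L'.length = L.length := by
      have := congrArg List.length (h1.1.trans hL.1.symm)
      simpa using this
    have hr : R'.length = R.length := by
      have := congrArg List.length (h1.2.2.trans hR.1.symm)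
      simpa using this
    simp only [src] at h2
    obtain ⟨h5, rfl⟩ := List.append_inj' h2 hr
    obtain ⟨rfl, h6⟩ := List.append_inj h5 hl
    refine ⟨π, ?_, rfl⟩
    rw [Set.Finite.mem_toFinset]
    exact ⟨h1.2.1, h6, fun A hA => h3 A (by simp [labels, hA]), h4⟩
  · intro π _
    rfl

section Pieces

variable {N : ℕ} {L R : List (Dir × Finset ℤ)} {l r : List (Dir × ℕ)}

theorem transfer_cup (hL : IsLabelled N L l) (hR : IsLabelled N R r) (d : Dir) (n : ℕ) (g) :
    transfer N ⟨l, .cup d n, r⟩ g (L ++ R) = ∑ A ∈ (moyIndex N).powersetCard n,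
      qHalf ^ (MOYPiece.cup d A).exponent N * g (L ++ [(d, A), (d.flip, A)] ++ R) := by
  have h := transfer_eq_sum_labellings hL hR (.cup d n) g []
  rw [List.append_nil] at h
  rw [h]
  symm
  refine Finset.sum_bij (fun A _ => .cup d A) ?_ ?_ ?_ ?_
  · intro A hA
    rw [Finset.mem_powersetCard] at hA
    rw [Set.Finite.mem_toFinset]
    exact ⟨by simp [MOYPiece.map, hA.2], rfl, by simpa [MOYPiece.labels] using hA.1, trivial⟩
  · intro A _ B _ h
    simpa using h
  · intro π hπ
    rw [Set.Finite.mem_toFinset] at hπ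
    obtain ⟨h1, -, h3, -⟩ := hπ
    cases π <;> simp [MOYPiece.map] at h1
    obtain ⟨rfl, h1⟩ := h1
    exact ⟨_, Finset.mem_powersetCard.2 ⟨h3 _ (by simp [MOYPiece.labels]), h1⟩, rfl⟩
  · intro A _
    rfl

theorem transfer_cap (hL : IsLabelled N L l) (hR : IsLabelled N R r) (d : Dir) {n : ℕ} (g)
    {A B : Finset ℤ} (hA : A ⊆ moyIndex N) (hn : A.card = n) :
    transfer N ⟨l, .cap d n, r⟩ g (L ++ [(d, A), (d.flip, B)] ++ R) =
      if A = B then qHalf ^ (MOYPiece.cap d A).exponent N * g (L ++ R) else 0 := by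
  rw [transfer_eq_sum_labellings hL hR]
  split_ifs with h
  · subst h
    rw [Finset.sum_eq_single_of_mem (.cap d A)]
    · simp [MOYPiece.top]
    · rw [Set.Finite.mem_toFinset]
      exact ⟨by simp [MOYPiece.map, hn], rfl, by simpa [MOYPiece.labels] using hA, trivial⟩
    · intro π hπ hne
      rw [Set.Finite.mem_toFinset] at hπ
      obtain ⟨h1, h2, -, -⟩ := hπ
      cases π <;> simp [MOYPiece.map] at h1
      simp [MOYPiece.bot] at h2
      simp [h2] at hne
  · refine Finset.sum_eq_zero fun π hπ => ?_
    rw [Set.Finite.mem_toFinset] at hπ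
    obtain ⟨h1, h2, -, -⟩ := hπ
    cases π <;> simp [MOYPiece.map] at h1
    simp [MOYPiece.bot] at h2
    exact absurd (h2.1.2.symm.trans h2.2.2) h

theorem transfer_merge (hL : IsLabelled N L l) (hR : IsLabelled N R r) {m n : ℕ} (g)
    {A B : Finset ℤ} (hA : A ⊆ moyIndex N) (hB : B ⊆ moyIndex N) (hm : A.card = m)
    (hn : B.card = n) :
    transfer N ⟨l, .merge m n, r⟩ g (L ++ [(.up, A), (.up, B)] ++ R) =
      if Disjoint A B then
        qHalf ^ (MOYPiece.merge A B).exponent N * g (L ++ [(.up, A ∪ B)] ++ R) else 0 := by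
  rw [transfer_eq_sum_labellings hL hR]
  split_ifs with h
  · rw [Finset.sum_eq_single_of_mem (.merge A B)]
    · rfl
    · rw [Set.Finite.mem_toFinset]
      exact ⟨by simp [MOYPiece.map, hm, hn], rfl, by simpa [MOYPiece.labels] using ⟨hA, hB⟩, h⟩
    · intro π hπ hne
      rw [Set.Finite.mem_toFinset] at hπ
      obtain ⟨h1, h2, -, -⟩ := hπ
      cases π <;> simp [MOYPiece.map] at h1
      simp [MOYPiece.bot] at h2
      simp [h2] at hne
  · refine Finset.sum_eq_zero fun π hπ => ?_
    rw [Set.Finite.mem_toFinset] at hπ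
    obtain ⟨h1, h2, -, h4⟩ := hπ
    cases π <;> simp [MOYPiece.map] at h1
    simp [MOYPiece.bot] at h2
    rw [MOYPiece.SumDisjoint, h2.1, h2.2] at h4
    exact absurd h4 h

theorem transfer_split (hL : IsLabelled N L l) (hR : IsLabelled N R r) {m n : ℕ} (g)
    {E : Finset ℤ} (hE : E ⊆ moyIndex N) (hmn : E.card = m + n) :
    transfer N ⟨l, .split m n, r⟩ g (L ++ [(.up, E)] ++ R) = ∑ A ∈ E.powersetCard m,
      qHalf ^ (MOYPiece.split A (E \ A)).exponent N *
        g (L ++ [(.up, A), (.up, E \ A)] ++ R) := by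
  rw [transfer_eq_sum_labellings hL hR]
  symm
  refine Finset.sum_bij (fun A _ => .split A (E \ A)) ?_ ?_ ?_ ?_
  · intro A hA
    rw [Finset.mem_powersetCard] at hA
    rw [Set.Finite.mem_toFinset]
    refine ⟨?_, ?_, ?_, Finset.disjoint_sdiff⟩
    · rw [MOYPiece.map, Finset.card_sdiff_of_subset hA.1, hmn, hA.2, Nat.add_sub_cancel_left]
    · simp [MOYPiece.bot, Finset.union_eq_right.2 hA.1]
    · intro B hB
      simp only [MOYPiece.labels, List.mem_cons, List.not_mem_nil, or_false] at hB
      rcases hB with rfl | rfl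
      exacts [hA.1.trans hE, Finset.sdiff_subset.trans hE]
  · intro A _ B _ h
    simp only [MOYPiece.split.injEq] at h
    exact h.1
  · intro π hπ
    rw [Set.Finite.mem_toFinset] at hπ
    obtain ⟨h1, h2, -, h4⟩ := hπ
    rcases π with _ | _ | _ | ⟨A, B⟩ <;> simp [MOYPiece.map] at h1
    simp [MOYPiece.bot] at h2
    subst h2
    refine ⟨A, Finset.mem_powersetCard.2 ⟨Finset.subset_union_left, h1.1⟩, ?_⟩
    rw [Finset.union_sdiff_cancel_left h4]
  · intro A _
    rfl

end Pieces

end MOYSlice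

/-! ### The bracket as a composition of transfer operators -/

namespace MOYGraph

open MOYSlice

/-- The states of an open graph with lower boundary `ρ` and empty upper boundary. -/
def openStates (N : ℕ) (w : List (MOYSlice ℕ)) (ρ : List (Dir × Finset ℤ)) :
    Set (List (MOYSlice (Finset ℤ))) :=
  {φ | φ.map (MOYSlice.map Finset.card) = w ∧
    Composes (MOYSlice.src (· ∪ ·)) (MOYSlice.tgt (· ∪ ·)) ρ φ [] ∧
    ∀ s ∈ φ, (∀ A ∈ s.labels, A ⊆ moyIndex N) ∧ s.piece.SumDisjoint}

theorem finite_openStates (N : ℕ) (w : List (MOYSlice ℕ)) (ρ) : (openStates N w ρ).Finite :=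
  (finite_lists_of_map _ _ (finite_moySlices (moyIndex N)) w).subset
    fun _ h => ⟨h.1, fun s hs => (h.2.2 s hs).1⟩

/-- A state is a labelling of the lowest slice together with a state of the rest whose lower
boundary is the upper row of that slice. The final function selects the empty row, since the graph
closes at the top. -/
theorem sum_openStates (N : ℕ) (w : List (MOYSlice ℕ)) (ρ : List (Dir × Finset ℤ)) :
    ∑ φ ∈ (finite_openStates N w ρ).toFinset, (φ.map fun s => qHalf ^ s.piece.exponent N).prod =
      transferAll N w (fun ρ => if ρ.isEmpty then 1 else 0) ρ := by
  induction w generalizing ρ with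
  | nil =>
    rw [transferAll]
    split_ifs with h
    · rw [Finset.sum_eq_single_of_mem []]
      · rfl
      · rw [Set.Finite.mem_toFinset]
        exact ⟨rfl, List.isEmpty_iff.1 h, by simp⟩
      · intro φ hφ hne
        rw [Set.Finite.mem_toFinset] at hφ
        exact absurd (List.map_eq_nil_iff.1 hφ.1) hne
    · refine Finset.sum_eq_zero fun φ hφ => ?_
      rw [Set.Finite.mem_toFinset] at hφ
      obtain ⟨h1, h2, -⟩ := hφ
      rw [List.map_eq_nil_iff.1 h1] at h2
      exact absurd (List.isEmpty_iff.2 h2) h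
  | cons t w ih =>
    rw [transferAll, transfer]
    simp only [← ih, Finset.mul_sum]
    rw [Finset.sum_sigma']
    symm
    refine Finset.sum_bij (fun x _ => x.1 :: x.2) ?_ ?_ ?_ ?_
    · rintro ⟨s, φ⟩ h
      rw [Finset.mem_sigma, Set.Finite.mem_toFinset, Set.Finite.mem_toFinset] at h
      rw [Set.Finite.mem_toFinset]
      obtain ⟨⟨h1, h2, h3⟩, h4, h5, h6⟩ := h
      exact ⟨by rw [List.map_cons, h1, h4], ⟨h2, h5⟩, by simpa using ⟨h3, h6⟩⟩
    · rintro ⟨s, φ⟩ _ ⟨s', φ'⟩ _ h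
      simp only [List.cons.injEq] at h
      rw [h.1, h.2]
    · intro φ h
      rw [Set.Finite.mem_toFinset] at h
      obtain ⟨h1, h2, h3⟩ := h
      obtain ⟨s, φ, rfl, h4, h5⟩ := List.map_eq_cons_iff.1 h1
      refine ⟨⟨s, φ⟩, ?_, rfl⟩
      rw [Finset.mem_sigma, Set.Finite.mem_toFinset, Set.Finite.mem_toFinset]
      exact ⟨⟨h4, h2.1, h3 s (by simp)⟩, h5, h2.2, fun s' hs' => h3 s' (by simp [hs'])⟩
    · rintro ⟨s, φ⟩ _
      simp

/-- The rotation number is a sum of signed half turns at minima and maxima, weighted by the index,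
so the whole exponent is additive over slices. -/
theorem bracket_eq_transferAll (N : ℕ) (Γ : MOYGraph) :
    Γ.bracket N = transferAll N Γ.word (fun ρ => if ρ.isEmpty then 1 else 0) [] := by
  rw [← sum_openStates, bracket]
  refine Finset.sum_congr ?_ ?_
  · ext φ
    rw [Set.Finite.mem_toFinset, Set.Finite.mem_toFinset]
    exact ⟨fun h => ⟨h.color, h.fits, fun s hs => ⟨h.subset s hs, h.disjoint s hs⟩⟩,
      fun h => ⟨h.1, h.2.1, fun s hs => (h.2.2 s hs).1, fun s hs => (h.2.2 s hs).2⟩⟩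
  · intro φ hφ
    clear hφ
    induction φ with
    | nil => simp [twiceRot]
    | cons s φ ih =>
      have h1 : twiceRot N (s :: φ) = ∑ i ∈ moyIndex N, i * s.piece.turn i + twiceRot N φ := by
        simp [twiceRot, mul_add, Finset.sum_add_distrib]
      rw [List.map_cons, List.map_cons, List.prod_cons, List.prod_cons, ← ih, h1,
        MOYPiece.exponent, zpow_add₀ RatFunc.X_ne_zero, zpow_add₀ RatFunc.X_ne_zero]
      ring

end MOYGraph

/-! ## The MOY state sum of a mostly 2-colored graph -/

namespace Pair

/-- The two-element set with given number. -/
def toSet : Pair → Finset ℤ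
  | s₁₂ => {-3, -1}
  | s₁₃ => {-3, 1}
  | s₁₄ => {-3, 3}
  | s₂₃ => {-1, 1}
  | s₂₄ => {-1, 3}
  | s₃₄ => {1, 3}

/-- The set on a strand with direction `d`: reversing a strand replaces the set by its
complement. -/
def label : Dir → Pair → Finset ℤ
  | .up, x => x.toSet
  | .down, x => x.compl.toSet

theorem card_label (d : Dir) (x : Pair) : (label d x).card = 2 := by
  cases d <;> cases x <;> rfl

theorem label_subset (d : Dir) (x : Pair) : label d x ⊆ moyIndex 4 := by
  cases d <;> cases x <;> decide +kernel

/-- The row of labelled strands with given directions. -/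
def labelRow (ds : List Dir) (xs : List Pair) : List (Dir × Finset ℤ) :=
  List.zipWith (fun d x => (d, label d x)) ds xs

theorem labelRow_append {ds ds' : List Dir} {xs xs' : List Pair} (h : ds.length = xs.length) :
    labelRow (ds ++ ds') (xs ++ xs') = labelRow ds xs ++ labelRow ds' xs' :=
  List.zipWith_append h

theorem isLabelled_labelRow {ds : List Dir} {xs : List Pair} (h : ds.length = xs.length) :
    IsLabelled 4 (labelRow ds xs) (ds.map colorTwo) := by
  induction ds generalizing xs with
  | nil => exact ⟨rfl, by simp [labelRow]⟩
  | cons d ds ih =>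
    cases xs with
    | nil => simp at h
    | cons x xs =>
      exact (isLabelled_singleton (label_subset d x) (card_label d x) d).append
        (ih (by simpa using h))

/-- The terms of a formal sum of rows of upward strands. -/
def setTerm (t : RowTerm) : (List (Finset ℤ) × ℤ) × ℤ := ((t.1.1.map toSet, t.1.2), t.2)

end Pair

/-! ### Matrices of the two configurations, minima and maxima -/

open MOYPiece in
/-- The terms of the state sum of a configuration of type one. -/
def typeOneTerms (A B : Finset ℤ) : Multiset ((List (Finset ℤ) × ℤ) × ℤ) :=
  if Disjoint A B then
    ((A ∪ B).powersetCard 2).val.map fun A' =>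
      (([A', (A ∪ B) \ A'], (merge A B).exponent 4 + (split A' ((A ∪ B) \ A')).exponent 4), 1)
  else 0

open MOYPiece in
/-- The terms of the state sum of a configuration of type two. -/
def typeTwoTerms (A B : Finset ℤ) : Multiset ((List (Finset ℤ) × ℤ) × ℤ) :=
  (B.powersetCard 1).val.bind fun D =>
    if Disjoint A D then
      ((A ∪ D).powersetCard 2).val.bind fun A' =>
        if Disjoint ((A ∪ D) \ A') (B \ D) then
          {(([A', (A ∪ D) \ A' ∪ B \ D], (split D (B \ D)).exponent 4 + (merge A D).exponent 4 +
            (split A' ((A ∪ D) \ A')).exponent 4 +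
            (merge ((A ∪ D) \ A') (B \ D)).exponent 4), 1)}
        else 0
    else 0

/-- Disjoint two-element subsets of a four-element set are complementary, which is the condition at
a maximum. For such sets 4 - 2π(A, B) is minus the sum of A, so the merge weighs as much as a
maximum and the split as much as a minimum. -/
theorem typeOneTerms_toSet (x y : Pair) :
    typeOneTerms x.toSet y.toSet = ((Pair.capCupTerms x y).map Pair.setTerm : Multiset _) := by
  have h : (Pair.all.all fun x => Pair.all.all fun y => decide (typeOneTerms x.toSet y.toSet =
      ((Pair.capCupTerms x y).map Pair.setTerm : Multiset _))) = true := by decide +kernel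
  exact of_decide_eq_true (List.all_eq_true.1 (List.all_eq_true.1 h x x.mem_all) y y.mem_all)

/-- The vertex matrix of the model is by design the matrix of the square. Different states of the
square can have the same outer labels, so the terms are compared as multisets. -/
theorem typeTwoTerms_toSet (x y : Pair) :
    typeTwoTerms x.toSet y.toSet = ((Pair.vertexTerms x y).map Pair.setTerm : Multiset _) := by
  have h : (Pair.all.all fun x => Pair.all.all fun y => decide (typeTwoTerms x.toSet y.toSet =
      ((Pair.vertexTerms x y).map Pair.setTerm : Multiset _))) = true := by decide +kernel
  exact of_decide_eq_true (List.all_eq_true.1 (List.all_eq_true.1 h x x.mem_all) y y.mem_all)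

/-- Complementation permutes the six sets. It negates their sums, while reversing the direction
negates the turn, so the exponent is the same for both orientations. -/
theorem cup_labels (d : Dir) :
    ((moyIndex 4).powersetCard 2).val.map (fun A => (A, (MOYPiece.cup d A).exponent 4)) =
      (Pair.all.map fun z => (z.label d, z.arc) : Multiset _) := by
  cases d <;> decide +kernel

theorem cap_label (d : Dir) (x : Pair) : (MOYPiece.cap d (x.label d)).exponent 4 = x.arc := by
  cases d <;> cases x <;> decide +kernel

/-- The legs of a minimum or maximum lie on one edge and carry the same set but have opposite
directions. In terms of unoriented labels they are therefore complementary. -/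
theorem label_eq_label_flip (d : Dir) (x y : Pair) :
    x.label d = y.label d.flip ↔ y.beq x.compl = true := by
  have h : (Pair.all.all fun x => Pair.all.all fun y =>
      decide (x.label d = y.label d.flip ↔ y.beq x.compl = true)) = true := by
    cases d <;> decide +kernel
  exact of_decide_eq_true (List.all_eq_true.1 (List.all_eq_true.1 h x x.mem_all) y y.mem_all)

noncomputable def setValue (G : List (Finset ℤ) → QField) (z : (List (Finset ℤ) × ℤ) × ℤ) :
    QField :=
  z.2 * (qHalf ^ z.1.2 * G z.1.1)

theorem sum_setValue_setTerm (G : List (Finset ℤ) → QField) (T : List RowTerm) :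
    (((T.map Pair.setTerm : List _) : Multiset _).map (setValue G)).sum =
      RowTerm.sumValue (fun t => G (t.map Pair.toSet)) T := by
  rw [Multiset.map_coe, Multiset.sum_coe, List.map_map, RowTerm.sumValue]
  rfl

namespace MOYSlice

section Configurations

variable {L R : List (Dir × Finset ℤ)} {l r : List (Dir × ℕ)} {A B : Finset ℤ}

theorem transferAll_typeOne (hL : IsLabelled 4 L l) (hR : IsLabelled 4 R r) (g)
    (hA : A ⊆ moyIndex 4) (hB : B ⊆ moyIndex 4) (hA2 : A.card = 2) (hB2 : B.card = 2) :
    transferAll 4 [⟨l, .merge 2 2, r⟩, ⟨l, .split 2 2, r⟩] g (L ++ [(.up, A), (.up, B)] ++ R) =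
      ((typeOneTerms A B).map (setValue fun As => g (L ++ As.map (Prod.mk .up) ++ R))).sum := by
  rw [transferAll, transfer_merge hL hR _ hA hB hA2 hB2, typeOneTerms]
  split_ifs with h
  · rw [transferAll, transfer_split hL hR _ (Finset.union_subset hA hB)
      (by rw [Finset.card_union_of_disjoint h, hA2, hB2]), Finset.mul_sum, Multiset.map_map]
    refine Finset.sum_congr rfl fun A' _ => ?_
    simp only [Function.comp, setValue, transferAll, zpow_add₀ RowTerm.qHalf_ne_zero, List.map_cons,
      List.map_nil, Int.cast_one]
    ring
  · simp

theorem transferAll_typeTwo (hL : IsLabelled 4 L l) (hR : IsLabelled 4 R r) (g)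
    (hA : A ⊆ moyIndex 4) (hB : B ⊆ moyIndex 4) (hA2 : A.card = 2) (hB2 : B.card = 2) :
    transferAll 4 [⟨l ++ [(.up, 2)], .split 1 1, r⟩, ⟨l, .merge 2 1, [(.up, 1)] ++ r⟩,
        ⟨l, .split 2 1, [(.up, 1)] ++ r⟩, ⟨l ++ [(.up, 2)], .merge 1 1, r⟩] g
        (L ++ [(.up, A), (.up, B)] ++ R) =
      ((typeTwoTerms A B).map (setValue fun As => g (L ++ As.map (Prod.mk .up) ++ R))).sum := by
  rw [transferAll, show L ++ [(Dir.up, A), (.up, B)] ++ R = (L ++ [(.up, A)]) ++ [(.up, B)] ++ R by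
      simp, transfer_split (hL.append (isLabelled_singleton hA hA2 _)) hR _ hB (by rw [hB2]),
    typeTwoTerms, Multiset.map_bind, Multiset.sum_bind]
  refine Finset.sum_congr rfl fun D hD => ?_
  rw [Finset.mem_powersetCard] at hD
  have hBD : (B \ D).card = 1 := by rw [Finset.card_sdiff_of_subset hD.1, hB2, hD.2]
  have hBD' : B \ D ⊆ moyIndex 4 := Finset.sdiff_subset.trans hB
  have hR' := (isLabelled_singleton hBD' hBD .up).append hR
  rw [transferAll, show L ++ [(Dir.up, A)] ++ [(.up, D), (.up, B \ D)] ++ R =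
      L ++ [(.up, A), (.up, D)] ++ ([(.up, B \ D)] ++ R) by simp,
    transfer_merge hL hR' _ hA (hD.1.trans hB) hA2 hD.2]
  split_ifs with h
  · have hAD : A ∪ D ⊆ moyIndex 4 := Finset.union_subset hA (hD.1.trans hB)
    have hAD' : (A ∪ D).card = 2 + 1 := by rw [Finset.card_union_of_disjoint h, hA2, hD.2]
    rw [transferAll, transfer_split hL hR' _ hAD hAD', Finset.mul_sum, Finset.mul_sum,
      Multiset.map_bind, Multiset.sum_bind]
    refine Finset.sum_congr rfl fun A' hA' => ?_
    rw [Finset.mem_powersetCard] at hA'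
    have hC : ((A ∪ D) \ A').card = 1 := by
      rw [Finset.card_sdiff_of_subset hA'.1, hAD', hA'.2]
    rw [transferAll, show L ++ [(Dir.up, A'), (.up, (A ∪ D) \ A')] ++ ([(.up, B \ D)] ++ R) =
        (L ++ [(.up, A')]) ++ [(.up, (A ∪ D) \ A'), (.up, B \ D)] ++ R by simp,
      transfer_merge (hL.append (isLabelled_singleton (hA'.1.trans hAD) hA'.2 _)) hR _
        (Finset.sdiff_subset.trans hAD) hBD' hC hBD]
    split_ifs with h'
    · simp only [setValue, transferAll, zpow_add₀ RowTerm.qHalf_ne_zero, List.map_cons,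
        List.map_nil, Int.cast_one, Multiset.map_singleton, Multiset.sum_singleton,
        List.append_assoc, List.cons_append, List.nil_append]
      ring
    · simp
  · simp

end Configurations

end MOYSlice

/-! ### Agreement of the MOY state sum with the vertex model -/

namespace TwoSlice

open MOYSlice KVSlice RowTerm Pair

/-- Attaching directions to unoriented labels intertwines the two actions slice by slice. The
matrices agree by the computations above, and the idle strands on both sides are inert in both
models. -/
theorem transferAll_toMOY (s : TwoSlice) (g : List (Dir × Finset ℤ) → QField) {xs : List Pair}
    (hxs : xs.length = s.src.length) :
    transferAll 4 s.toMOY g (labelRow s.src xs) =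
      act s.toGraph (fun ys => g (labelRow s.tgt ys)) xs := by
  obtain ⟨l, p, r⟩ := s
  obtain ⟨a, b, c, rfl, ha, hb⟩ := exists_append_append
    (l := l.length) (n := p.bot.length) (r := r.length) (row := xs) (by simp [hxs, src, add_assoc])
  have hc : c.length = r.length := by
    simp [src] at hxs
    omega
  have hL := isLabelled_labelRow ha.symm
  have hR := isLabelled_labelRow hc.symm
  have hsrc : labelRow (src ⟨l, p, r⟩) (a ++ b ++ c) =
      labelRow l a ++ labelRow p.bot b ++ labelRow r c := by
    rw [src, labelRow_append (by simp [ha, hb]), labelRow_append ha.symm]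
  have htgt (t : List Pair) (ht : t.length = p.top.length) :
      labelRow (tgt ⟨l, p, r⟩) (a ++ t ++ c) =
        labelRow l a ++ labelRow p.top t ++ labelRow r c := by
    rw [tgt, labelRow_append (by simp [ha, ht]), labelRow_append ha.symm]
  rw [hsrc]
  have hrow (t : List Pair) (ht : t.length = 2) :
      labelRow [Dir.up, Dir.up] t = (t.map toSet).map (Prod.mk .up) := by
    obtain ⟨x, y, rfl⟩ := List.length_eq_two.1 ht
    rfl
  cases p with
  | cup d =>
    obtain rfl := List.length_eq_zero_iff.1 hb
    have h1 : act (toGraph ⟨l, .cup d, r⟩) (fun ys => g (labelRow (tgt ⟨l, .cup d, r⟩) ys))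
        (a ++ [] ++ c) = (all.map fun z => qHalf ^ z.arc *
          g (labelRow l a ++ [(d, z.label d), (d.flip, z.label d)] ++ labelRow r c)).sum := by
      simp only [toGraph, act]
      rw [terms_eq _ _ _ _ _ _ ha rfl, sumValue_mapRow, KVPiece.terms, sumValue, List.map_map]
      congr 1
      refine List.map_congr_left fun z _ => ?_
      simp only [Function.comp, value, Int.cast_one, one_mul]
      rw [htgt _ rfl]
      -- The complement in the label of the second leg compensates for its opposite direction, so
      -- both legs carry the same set.
      cases d <;> simp [labelRow, TwoPiece.top, label, Dir.flip, compl_compl]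
    rw [h1]
    have h2 := transfer_cup hL hR d 2 g
    simp only [toMOY, transferAll]
    rw [show labelRow (TwoPiece.cup d).bot [] = [] from rfl, List.append_nil, h2]
    have h3 := congrArg (fun m => (Multiset.map (fun x : Finset ℤ × ℤ => qHalf ^ x.2 *
      g (labelRow l a ++ [(d, x.1), (d.flip, x.1)] ++ labelRow r c)) m).sum) (cup_labels d)
    simp only [Multiset.map_map, Multiset.map_coe, Multiset.sum_coe, List.map_map] at h3
    exact h3
  | cap d =>
    obtain ⟨x, y, rfl⟩ := List.length_eq_two.1 hb
    have h1 : act (toGraph ⟨l, .cap d, r⟩) (fun ys => g (labelRow (tgt ⟨l, .cap d, r⟩) ys))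
        (a ++ [x, y] ++ c) = if y.beq x.compl = true then qHalf ^ x.arc *
          g (labelRow l a ++ labelRow r c) else 0 := by
      simp only [toGraph, act]
      rw [terms_eq _ _ _ _ _ _ ha rfl, sumValue_mapRow, KVPiece.terms]
      split_ifs with h
      · rw [h, cond_true, sumValue_cons, sumValue_nil]
        simp only [value, Int.cast_one, one_mul, add_zero]
        rw [htgt _ rfl, show labelRow (TwoPiece.cap d).top [] = [] from rfl, List.append_nil]
      · rw [Bool.eq_false_iff.2 h, cond_false, sumValue_nil]
    rw [h1]
    have h2 := transfer_cap hL hR d g (B := y.label d.flip) (label_subset d x) (card_label d x)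
    simp only [label_eq_label_flip, cap_label] at h2
    exact h2
  | typeOne =>
    obtain ⟨x, y, rfl⟩ := List.length_eq_two.1 hb
    have h2 := transferAll_typeOne hL hR g (label_subset .up x) (label_subset .up y)
      (card_label .up x) (card_label .up y)
    rw [show x.label .up = x.toSet from rfl, show y.label .up = y.toSet from rfl,
      typeOneTerms_toSet, sum_setValue_setTerm] at h2
    refine h2.trans ?_
    have h3 := act_widen (w := [⟨0, .cap, 0⟩, ⟨0, .cup, 0⟩]) (n := 2) (m := 2) ⟨rfl, rfl, rfl⟩
      l.length r.length (fun ys => g (labelRow (tgt ⟨l, .typeOne, r⟩) ys)) c ha hb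
    refine Eq.trans ?_ h3.symm
    rw [act_capCup]
    refine sumValue_congr fun t ht => ?_
    have ht2 : t.1.1.length = 2 := by
      simp only [capCupTerms] at ht
      cases h : y.beq x.compl
      · simp [h] at ht
      · rw [h, cond_true] at ht
        obtain ⟨z, -, rfl⟩ := List.mem_map.1 ht
        rfl
    rw [htgt _ ht2, ← hrow _ ht2]
    rfl
  | typeTwo =>
    obtain ⟨x, y, rfl⟩ := List.length_eq_two.1 hb
    have h2 := transferAll_typeTwo hL hR g (label_subset .up x) (label_subset .up y)
      (card_label .up x) (card_label .up y)
    rw [show x.label .up = x.toSet from rfl, show y.label .up = y.toSet from rfl,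
      typeTwoTerms_toSet, sum_setValue_setTerm] at h2
    refine h2.trans ?_
    simp only [toGraph, act]
    rw [terms_eq _ _ _ _ _ _ ha hb, sumValue_mapRow]
    refine sumValue_congr fun t ht => ?_
    have ht2 : t.1.1.length = 2 := length_of_mem_pieceTerms (p := .vertex) (b := [x, y]) ht hb
    rw [htgt _ ht2, ← hrow _ ht2]
    rfl

end TwoSlice

namespace MostlyTwoColored

open MOYSlice KVSlice Pair

theorem transferAll_flatMap {b : List Dir} {w : List TwoSlice}
    (hw : Composes TwoSlice.src TwoSlice.tgt b w []) {xs : List Pair} (hxs : xs.length = b.length) :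
    transferAll 4 (w.flatMap TwoSlice.toMOY) (fun ρ => if ρ.isEmpty then 1 else 0)
        (labelRow b xs) =
      act (w.flatMap TwoSlice.toGraph) (fun _ => 1) xs := by
  induction w generalizing b xs with
  | nil =>
    rw [show b = [] from hw] at hxs ⊢
    obtain rfl := List.length_eq_zero_iff.1 hxs
    rfl
  | cons s w ih =>
    obtain ⟨rfl, h2⟩ := hw
    rw [List.flatMap_cons, List.flatMap_cons, transferAll_append, act_append,
      TwoSlice.transferAll_toMOY s _ hxs]
    exact act_congr (TwoSlice.toGraph_composes s) (fun ys hys => ih h2 hys) hxs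

theorem bracket_toMOY (Γ : MostlyTwoColored) : Γ.toMOY.bracket 4 = Γ.toGraph.vertexModel := by
  rw [MOYGraph.bracket_eq_transferAll]
  exact transferAll_flatMap Γ.closed (xs := []) rfl

end MostlyTwoColored

/-- The first conjunct certifies that the chosen polynomial really comes from the relations and is
not the default value 0; the specialization argument then applies to it. -/
theorem mainTheorem6 (Γ : MostlyTwoColored) :
    Γ.toGraph.IsKauffmanVogel Γ.toGraph.kauffmanVogel ∧
      Γ.toMOY.bracket 4 = Γ.toGraph.kauffmanVogelSO 6 := by
  have h := Γ.toGraph.exists_isKauffmanVogel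
  have h1 : Γ.toGraph.IsKauffmanVogel Γ.toGraph.kauffmanVogel := by
    rw [KnottedGraph.kauffmanVogel, dif_pos h]
    exact h.choose_spec
  exact ⟨h1, Γ.bracket_toMOY.trans h1.specialize_eq.symm⟩
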